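/- **Setting.** There are $n$ parties, at most $f$ of which, $3f<n$, are ever corrupted by an adaptive Byzantine adversary; the others are *honest*. Time is counted in steps. Channels are authenticated, and a message sent by an honest party to an honest party at time $x$ arrives by time $\max\{\mathsf{GST},x\}+\Delta$, where $\Delta\ge 1$ is known and $\mathsf{GST}$ is not. **Protocol (HammerHead).** Parties disseminate vertices by (Bracha's) reliable broadcast. A vertex of round $r\ge 1$ carries a block and edges to at least $n-f$ vertices of round $r-1$ (round $0$ consists of one genesis vertex per party). A party adds a delivered vertex to its local DAG as soon as all vertices it points to are there. A schedule $S$ has a number, an initial round and a leader for each even round; the anchor of an even round is the vertex, if any, of the leader which the party's active schedule gives to that round. The party starts with schedule $S_0$ (number $0$, initial round $0$, arbitrary leaders common to all parties) in round $1$. On entering a round $r$ it broadcasts a vertex that points to all vertices of round $r-1$ in its DAG. It leaves round $r$ for round $r+1$ when its DAG holds $n-f$ vertices of round $r$ and, if $r$ is even, also the anchor of round $r$ or a timeout $\tau\ge 6\Delta$ has expired; if its DAG comes to hold $n-f$ vertices of a round $r'$ later than its current one, it enters round $r'+1$ at once. The anchor $w$ of a round $r$ above the last ordered round (initially $0$)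 is committed when some vertex of round $r+2$ in the DAG points to at least $f+1$ vertices of round $r+1$ that point to $w$. Then the party walks back from $w$ through the even rounds above the last ordered one, collecting each anchor that is reachable from the last one collected, and processes the collected anchors from the earliest to the latest. An anchor $a$ with $\mathrm{round}(a)<S.\mathsf{initialRound}+\mathsf T$ has its causal history ordered. At the first anchor $a$ with $\mathrm{round}(a)\ge S.\mathsf{initialRound}+\mathsf T$ the party switches from $S=S_k$ to a schedule $S_{k+1}$ with initial round $\mathrm{round}(a)$, whose leaders are computed by an arbitrary fixed deterministic rule from $S_k$, $a$ and the causal history of $a$; later anchors collected under $S_k$ are dropped, and the DAG above $\mathrm{round}(a)$ is re-examined under $S_{k+1}$. Otherwise, the last ordered round becomes the round of $w$. **Lemma (Liveness).** For all $n,f,\mathsf T,\Delta,\tau$ as above and every $W$ there is a number $B$ such that the following holds for every schedule-change rule, every initial schedule and every execution of HammerHead (whatever $\mathsf{GST}$, the adversary and the proposed blocks are). Let $S_{\max}$ be the latest schedule that any honest party has advanced to before $\mathsf{GST}$, and suppose that among any $W$ consecutive even rounds at least one has an honest leader according to $S_{\max}$. Then some honest party enters the schedule number $S_{\max}+1$ by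 time $\mathsf{GST}+B$. -/

import Mathlib

/- The HammerHead protocol: a DAG-based atomic broadcast (eventually synchronous Bullshark)
whose leader schedule is recomputed along the committed anchors, run over a partially synchronous
network against a Byzantine adversary.  Time is discrete: one unit of time is one step. -/

namespace HammerHead

universe u

/-- Numerical parameters: `n` parties of which at most `f` are faulty, the schedule-change frequency
`T`, the timeout of a round, and the message-delay bound `delta` of the network. -/
structure Params where
  n : ℕ
  f : ℕ
  T : ℕ
  timeout : ℕ
  delta : ℕ

/-- A party. -/
abbrev Party (c : Params) : Type := Fin c.n

/-- A vertex of the DAG.  Reliable broadcast leaves at most one vertex per round and source, so the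
vertices of round `round - 1` that a vertex points to are named by their sources. -/
structure Vertex (c : Params) (Block : Type u) where
  round : ℕ
  source : Party c
  block : Block
  edges : Finset (Party c)

/-- A leader schedule: its number in the sequence `S_0, S_1, …` of schedules, the round in
which it starts, and the leader it gives to each round (used in even rounds only). -/
structure Schedule (c : Params) where
  index : ℕ
  initialRound : ℕ
  leader : ℕ → Party c

/-- The data of a protocol instance that all parties share: the block of the genesis vertices,
the leaders of the initial schedule, and an arbitrary deterministic schedule-change rule, which
computes the leaders of the next schedule from the current schedule, the anchor at which the
schedule is changed, and the causal history of that anchor. -/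
structure Protocol (c : Params) (Block : Type u) where
  genesisBlock : Block
  initialLeader : ℕ → Party c
  nextLeader : Schedule c → Vertex c Block → Set (Vertex c Block) → (ℕ → Party c)

/-- Messages of the reliable broadcast (of Bracha) that disseminates vertices. -/
inductive Msg (c : Params) (Block : Type u) where
  | init (v : Vertex c Block)
  | echo (v : Vertex c Block)
  | ready (v : Vertex c Block)

/-- The vertex that a message is about. -/
def Msg.vertex {c : Params} {Block : Type u} : Msg c Block → Vertex c Block
  | .init v => v
  | .echo v => v
  | .ready v => v

/-- Local state of a party. -/
structure State (c : Params) (Block : Type u) where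
  /-- the party itself -/
  self : Party c
  /-- the block it proposes in each round -/
  proposal : ℕ → Block
  /-- messages received so far, with the sender -/
  inbox : Finset (Party c × Msg c Block)
  /-- messages multicast so far -/
  sent : Finset (Msg c Block)
  /-- vertices that reliable broadcast has delivered -/
  delivered : Finset (Vertex c Block)
  /-- delivered vertices that wait for their causal history -/
  buffer : List (Vertex c Block)
  /-- the local DAG -/
  dag : Finset (Vertex c Block)
  /-- current round -/
  round : ℕ
  /-- time since the current round was entered -/
  elapsed : ℕ
  /-- the active schedule -/
  schedule : Schedule c
  /-- round of the last anchor that was ordered or changed the schedule -/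
  lastOrderedRound : ℕ
  /-- vertices ordered (atomically delivered) so far -/
  ordered : Finset (Vertex c Block)

noncomputable section

open scoped Classical

variable {c : Params} {Block : Type u}

/-! ### The DAG -/

/-- `v` points to the vertex `u` of the DAG `d`. -/
def Edge (d : Finset (Vertex c Block)) (v u : Vertex c Block) : Prop :=
  u ∈ d ∧ u.round + 1 = v.round ∧ u.source ∈ v.edges

/-- There is a path from `v` to `u` in the DAG `d`. -/
def Path (d : Finset (Vertex c Block)) : Vertex c Block → Vertex c Block → Prop :=
  Relation.ReflTransGen (Edge d)

/-- The vertices of round `r` in the DAG. -/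
def State.layer (s : State c Block) (r : ℕ) : Finset (Vertex c Block) :=
  s.dag.filter fun v => v.round = r

/-- The vertex of the leader of round `r` according to the active schedule, if it is in the DAG. -/
def State.getAnchor (s : State c Block) (r : ℕ) : Option (Vertex c Block) :=
  if h : ∃ v ∈ s.layer r, v.source = s.schedule.leader r then some h.choose else none

/-! ### Committing anchors and changing the schedule -/

/-- The new schedule computed at the anchor `a`. -/
def updateSchedule (P : Protocol c Block) (s : State c Block) (a : Vertex c Block) : Schedule c where
  index := s.schedule.index + 1
  initialRound := a.round
  leader := P.nextLeader s.schedule a {v | Path s.dag a v}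

/-- Processes a stack of anchors, from the earliest to the latest.  At the first anchor that has
reached the schedule-change round the schedule is changed; the remaining anchors were chosen by the
outdated schedule and are dropped, so that the new schedule applies to all rounds from here on. -/
def orderHistory (P : Protocol c Block) : State c Block → List (Vertex c Block) → State c Block
  | s, [] => s
  | s, a :: rest =>
    if s.schedule.initialRound + c.T ≤ a.round then
      { s with schedule := updateSchedule P s a, lastOrderedRound := a.round }
    else
      orderHistory P
        { s with
          ordered := s.ordered ∪ s.dag.filter fun v => 0 < v.round ∧ Path s.dag a v } rest

/-- Walks back from `anchor` through the rounds `r, r - 2, …` above the last ordered round, and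
pushes each previous anchor that can be reached from the last one pushed. -/
def collectAnchors (s : State c Block) :
    ℕ → Vertex c Block → List (Vertex c Block) → List (Vertex c Block)
  | 0, _, stack => stack
  | 1, _, stack => stack
  | r + 2, anchor, stack =>
    if s.lastOrderedRound < r + 2 then
      match s.getAnchor (r + 2) with
      | some prev =>
        if Path s.dag anchor prev then collectAnchors s r prev (prev :: stack)
        else collectAnchors s r anchor stack
      | none => collectAnchors s r anchor stack
    else stack

/-- Orders the anchor `w` together with the earlier anchors it leads to. -/
def orderAnchors (P : Protocol c Block) (s : State c Block) (w : Vertex c Block) : State c Block :=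
  orderHistory P { s with lastOrderedRound := w.round }
    (collectAnchors s (w.round - 2) w [w])

/-- The anchor of the even round `r`, not yet passed, has at least `f + 1` votes among the edges of
some vertex of round `r + 2` of the DAG. -/
def Committable (s : State c Block) (r : ℕ) : Prop :=
  Even r ∧ s.lastOrderedRound < r ∧
    ∃ w, s.getAnchor r = some w ∧
      ∃ v ∈ s.layer (r + 2),
        c.f + 1 ≤ ((s.layer (r + 1)).filter fun u => u.source ∈ v.edges ∧ Path s.dag u w).card

/-- Orders the earliest committable anchor, if there is one. -/
def commitStep (P : Protocol c Block) (s : State c Block) : State c Block :=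
  if h : ∃ r, Committable s r then
    match s.getAnchor (Nat.find h) with
    | some w => orderAnchors P s w
    | none => s
  else s

/-- Commits as long as possible.  After a change of schedule the whole DAG is examined again,
which applies the new schedule retroactively.  Each effective step passes a further anchor of the
DAG, so that the number of steps allowed here is never exhausted. -/
def commitAll (P : Protocol c Block) (s : State c Block) : State c Block :=
  (commitStep P)^[s.dag.card] s

/-! ### Construction of the DAG -/

/-- Enters round `r` and broadcasts a new vertex that points to all known vertices of the previous
round. -/
def enterRound (s : State c Block) (r : ℕ) : State c Block :=
  { s with
    round := r
    elapsed := 0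
    sent := insert (Msg.init ⟨r, s.self, s.proposal r, (s.layer (r - 1)).image Vertex.source⟩)
      s.sent }

/-- Leaves the current round once it has `n - f` vertices; in an even round also the anchor is
waited for, until the timeout. -/
def tryAdvance (s : State c Block) : State c Block :=
  if c.n - c.f ≤ (s.layer s.round).card ∧
      (Odd s.round ∨ (s.getAnchor s.round).isSome ∨ c.timeout ≤ s.elapsed) then
    enterRound s (s.round + 1)
  else s

/-- Adds `v` to the DAG, commits what can be committed, and advances the round; a party that lags
behind a round with `n - f` vertices moves past that round at once. -/
def addToDag (P : Protocol c Block) (s : State c Block) (v : Vertex c Block) : State c Block :=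
  let s' := commitAll P { s with dag := insert v s.dag }
  if s'.round < v.round ∧ c.n - c.f ≤ (s'.layer v.round).card then enterRound s' (v.round + 1)
  else tryAdvance s'

/-- All vertices that `v` points to are in the DAG. -/
def Addable (s : State c Block) (v : Vertex c Block) : Prop :=
  ∀ p ∈ v.edges, ∃ u ∈ s.dag, u.round + 1 = v.round ∧ u.source = p

/-- Moves one vertex whose causal history is present from the buffer to the DAG. -/
def drainStep (P : Protocol c Block) (s : State c Block) : State c Block :=
  match s.buffer.find? (fun v => decide (Addable s v)) with
  | some v => addToDag P { s with buffer := s.buffer.erase v } v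
  | none => s

/-- Moves all vertices whose causal history is present from the buffer to the DAG. -/
def drain (P : Protocol c Block) (s : State c Block) : State c Block :=
  (drainStep P)^[s.buffer.length] s

/-! ### Reliable broadcast -/

/-- `v` and `u` belong to the same instance of reliable broadcast. -/
def SameInstance (v u : Vertex c Block) : Prop := v.round = u.round ∧ v.source = u.source

/-- The number of parties from which the message `m` was received. -/
def State.count (s : State c Block) (m : Msg c Block) : ℕ :=
  (Finset.univ.filter fun q => (q, m) ∈ s.inbox).card

/-- Echo the first vertex received from the source of an instance. -/
def tryEcho (s : State c Block) (v : Vertex c Block) : State c Block :=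
  if (v.source, Msg.init v) ∈ s.inbox ∧ ∀ u, Msg.echo u ∈ s.sent → ¬ SameInstance u v then
    { s with sent := insert (Msg.echo v) s.sent }
  else s

/-- Get ready for `v` on more than `(n + f) / 2` echoes or on `f + 1` ready messages. -/
def tryReady (s : State c Block) (v : Vertex c Block) : State c Block :=
  if (c.n + c.f < 2 * s.count (Msg.echo v) ∨ c.f + 1 ≤ s.count (Msg.ready v)) ∧
      ∀ u, Msg.ready u ∈ s.sent → ¬ SameInstance u v then
    { s with sent := insert (Msg.ready v) s.sent }
  else s

/-- Deliver `v` on `2 f + 1` ready messages; a vertex without `n - f` edges is discarded. -/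
def tryDeliver (P : Protocol c Block) (s : State c Block) (v : Vertex c Block) : State c Block :=
  if 2 * c.f + 1 ≤ s.count (Msg.ready v) ∧ ∀ u ∈ s.delivered, ¬ SameInstance u v then
    if 1 ≤ v.round ∧ c.n - c.f ≤ v.edges.card then
      drain P { s with delivered := insert v s.delivered, buffer := v :: s.buffer }
    else { s with delivered := insert v s.delivered }
  else s

/-! ### One step of a party -/

/-- Reaction to the receipt of a message. -/
def receive (P : Protocol c Block) (s : State c Block) (x : Party c × Msg c Block) :
    State c Block :=
  tryDeliver P
    (tryReady (tryEcho { s with inbox := insert x s.inbox } x.2.vertex) x.2.vertex) x.2.vertex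

/-- One time step: handle the messages that arrive, in the given order, then the timer. -/
def step (P : Protocol c Block) (s : State c Block) (msgs : List (Party c × Msg c Block)) :
    State c Block :=
  let s' := msgs.foldl (receive P) s
  tryAdvance { s' with elapsed := s'.elapsed + 1 }

/-- The state in which party `p` starts: the DAG holds the genesis vertices of round `0`, the
initial schedule is active, and `p` enters round `1`. -/
def initialState (P : Protocol c Block) (p : Party c) (proposal : ℕ → Block) : State c Block :=
  enterRound
    { self := p
      proposal := proposal
      inbox := ∅
      sent := ∅
      delivered := ∅
      buffer := []
      dag := Finset.univ.image fun q : Party c => ⟨0, q, P.genesisBlock, ∅⟩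
      round := 0
      elapsed := 0
      schedule := ⟨0, 0, P.initialLeader⟩
      lastOrderedRound := 0
      ordered := ∅ } 1

end

/-! ### Executions -/

/-- An execution with at most `f` faulty parties in a partially synchronous network.  The parties
outside `honest` are unconstrained: they may crash or send anything to anyone at any time. -/
structure Execution {c : Params} {Block : Type u} (P : Protocol c Block) where
  /-- the parties that are never corrupted -/
  honest : Finset (Party c)
  /-- the global stabilization time -/
  GST : ℕ
  /-- the blocks that the parties propose -/
  proposal : Party c → ℕ → Block
  /-- `state t p` is the state of `p` at time `t` -/
  state : ℕ → Party c → State c Block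
  /-- the messages that `p` receives between the times `t` and `t + 1`, with their senders -/
  received : ℕ → Party c → List (Party c × Msg c Block)
  few_faulty : c.n ≤ honest.card + c.f
  state_zero : ∀ p ∈ honest, state 0 p = initialState P p (proposal p)
  state_succ : ∀ p ∈ honest, ∀ t, state (t + 1) p = step P (state t p) (received t p)
  /-- channels are authenticated -/
  authentic : ∀ p ∈ honest, ∀ q ∈ honest, ∀ t m,
    (q, m) ∈ received t p → m ∈ (state t q).sent
  /-- a message sent at time `t` arrives by time `max GST t + delta` -/
  delivery : ∀ p ∈ honest, ∀ q ∈ honest, ∀ t m,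
    m ∈ (state t q).sent → ∃ t' < max GST t + c.delta, (q, m) ∈ received t' p

/-- `S` is the latest schedule that an honest party has advanced to before `GST`. -/
def Execution.IsLatestScheduleBeforeGST {c : Params} {Block : Type u} {P : Protocol c Block}
    (E : Execution P) (S : Schedule c) : Prop :=
  (∃ p ∈ E.honest, ∃ t ≤ E.GST, (E.state t p).schedule = S) ∧
    ∀ q ∈ E.honest, ∀ t ≤ E.GST, (E.state t q).schedule.index ≤ S.index

/-- By time `t`, party `p` has entered the schedule number `k`.  A change of schedule raises the
number by exactly one, so a party has entered all schedules up to its active one. -/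
def Execution.HasEntered {c : Params} {Block : Type u} {P : Protocol c Block}
    (E : Execution P) (t : ℕ) (p : Party c) (k : ℕ) : Prop :=
  k ≤ (E.state t p).schedule.index

/-- Among any `W` consecutive even rounds, at least one is led by a party in `H`. -/
def Schedule.HasLeadersIn {c : Params} (S : Schedule c) (W : ℕ) (H : Finset (Party c)) : Prop :=
  ∀ j : ℕ, ∃ i < W, S.leader (2 * (j + i)) ∈ H

end HammerHead

/-!
Suppose that up to time `GST + B` no honest party advances beyond `S`, the latest schedule reached
before `GST`.

*Reliable broadcast.*  Two quorums of echoes share an honest party, so no two honest parties are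
ready for different vertices of one instance (`Execution.ready_agree`).  After `GST`, a vertex in
the DAG of one honest party is in all honest DAGs within `2 * delta` (`Execution.dag_subset`), and a
vertex broadcast by an honest party within `3 * delta` (`Execution.mem_dag_of_init`).

*Agreement on schedules.*  If an anchor `w` is supported, i.e. can be committed, then by quorum
intersection every vertex two or more rounds above it has a path to it (`Supported.path`).
All walks back from higher anchors thus pass through `w`, and the anchor at which `S` is changed,
the lowest one collected from the threshold of `S` on, does not depend on where the walk started
(`Supported.lowestAnchor_unique`).  So a DAG determines at most one schedule of each number
(`Chain.unique`).  Since `commitAll` stops only when nothing can be committed, a party whose DAG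
contains that of another one is not behind it (`Chain.index_le`).  Hence from `GST + 2 * delta`
until `GST + B` all honest parties have the schedule `S`.

*Progress.*  A full layer, one with `n - f` vertices, pulls all honest parties to its round, and
the timeout drives them past it, so the maximal honest round increases at least once every
`roundTime` (`Execution.exists_succ_round`).  Even rounds are never skipped: a vertex of
round `r` enters a DAG only after `n - f` vertices of round `r - 1`, and if `r` is even, these alone
take the party to round `r`, as odd rounds are left without waiting.

*An honest leader.*  Let `r` be an even round past the threshold of `S`, with an honest leader and
not yet entered by an honest party at `GST + 2 * delta`, and let `x + 1` be the first time at which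
one enters it.  By time `x + 2 * delta` the leader has entered `r`, and by `x + 5 * delta` its
vertex is in all honest DAGs, which is before any timeout of round `r`.  Hence every honest
vertex of round `r + 1` points to it (`Execution.votes_for_leader`).  Any vertex of round `r + 2`
points to at least `f + 1` of these, so the leader's vertex can be committed
(`Execution.exists_supported`) by a party that still has schedule `S`, although nothing is left to
commit.  As the initial round of `S` is at most one above the maximal honest round at
`GST + 2 * delta`, the rounds that remain until `r + 3`, and with them `B`, are bounded in terms of
the parameters and `W` only.
-/

namespace HammerHead

open scoped Classical

universe u

variable {c : Params} {Block : Type u}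

/-! ### Causally closed DAGs -/

/-- A local DAG as reliable broadcast produces it: at most one vertex per round and source, every
edge leads to a vertex of the DAG, and vertices of positive rounds have at least `n - f` edges. -/
structure IsDag (d : Finset (Vertex c Block)) : Prop where
  inj : ∀ u ∈ d, ∀ v ∈ d, u.round = v.round → u.source = v.source → u = v
  closed : ∀ v ∈ d, ∀ q ∈ v.edges, ∃ u ∈ d, u.round + 1 = v.round ∧ u.source = q
  card_edges : ∀ v ∈ d, 1 ≤ v.round → c.n - c.f ≤ v.edges.card

theorem Path.mono {d D : Finset (Vertex c Block)} (h : d ⊆ D) {v u : Vertex c Block}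
    (p : Path d v u) : Path D v u := by
  induction p with
  | refl => exact .refl
  | tail _ e ih => exact ih.tail ⟨h e.1, e.2⟩

theorem Path.mem {d : Finset (Vertex c Block)} {v u : Vertex c Block} (p : Path d v u)
    (hv : v ∈ d) : u ∈ d := by
  induction p with
  | refl => exact hv
  | tail _ e _ => exact e.1

/-- The causal history of a vertex is the same in all DAGs that contain it. -/
theorem IsDag.path_iff {d D : Finset (Vertex c Block)} (hd : IsDag d) (hD : IsDag D)
    (h : d ⊆ D) {v u : Vertex c Block} (hv : v ∈ d) : Path D v u ↔ Path d v u := by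
  refine ⟨fun p => ?_, Path.mono h⟩
  induction p with
  | refl => exact .refl
  | tail _ e ih =>
    obtain ⟨x, hx, hxr, hxs⟩ := hd.closed _ (Path.mem ih hv) _ e.2.2
    obtain rfl := hD.inj x (h hx) _ e.1 (by have := e.2.1; omega) hxs
    exact ih.tail ⟨hx, e.2⟩

theorem IsDag.exists_round {d : Finset (Vertex c Block)} (hd : IsDag d) (hf : 3 * c.f < c.n)
    {v : Vertex c Block} (hv : v ∈ d) {r : ℕ} (hr : r ≤ v.round) : ∃ u ∈ d, u.round = r := by
  induction k : v.round - r generalizing v with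
  | zero => exact ⟨v, hv, by omega⟩
  | succ k ih =>
    have hc := hd.card_edges v hv (by omega)
    obtain ⟨q, hq⟩ := Finset.card_pos.1 (show 0 < v.edges.card by omega)
    obtain ⟨u, hu, hur, -⟩ := hd.closed v hv q hq
    exact ih hu (by omega) (by omega)

theorem State.mem_layer {s : State c Block} {r : ℕ} {v : Vertex c Block} :
    v ∈ s.layer r ↔ v ∈ s.dag ∧ v.round = r := by
  simp [State.layer]

theorem IsDag.card_layer_sources {s : State c Block} (hd : IsDag s.dag) (r : ℕ) :
    ((s.layer r).image Vertex.source).card = (s.layer r).card := by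
  refine Finset.card_image_of_injOn fun u hu v hv h => ?_
  have hu := State.mem_layer.1 hu
  have hv := State.mem_layer.1 hv
  exact hd.inj u hu.1 v hv.1 (hu.2.trans hv.2.symm) h

/-- Below a vertex, every layer of a DAG has at least `n - f` vertices. -/
theorem IsDag.card_layer {s : State c Block} (hd : IsDag s.dag) (hf : 3 * c.f < c.n)
    {v : Vertex c Block} (hv : v ∈ s.dag) {r : ℕ} (hr : r < v.round) :
    c.n - c.f ≤ (s.layer r).card := by
  obtain ⟨u, hu, hur⟩ := hd.exists_round hf hv (Nat.succ_le_of_lt hr)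
  rw [← hd.card_layer_sources r]
  refine (hd.card_edges u hu (by omega)).trans (Finset.card_le_card fun q hq => ?_)
  obtain ⟨x, hx, hxr, hxs⟩ := hd.closed u hu q hq
  exact Finset.mem_image.2 ⟨x, State.mem_layer.2 ⟨hx, by omega⟩, hxs⟩

theorem State.getAnchor_eq_some {s : State c Block} (hd : IsDag s.dag) {r : ℕ}
    {w : Vertex c Block} :
    s.getAnchor r = some w ↔ w ∈ s.dag ∧ w.round = r ∧ w.source = s.schedule.leader r := by
  unfold State.getAnchor
  split_ifs with h
  · have hc := h.choose_spec
    have hm := State.mem_layer.1 hc.1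
    constructor
    · intro e
      rw [← Option.some.inj e]
      exact ⟨hm.1, hm.2, hc.2⟩
    · rintro ⟨h1, h2, h3⟩
      rw [hd.inj _ hm.1 w h1 (hm.2.trans h2.symm) (hc.2.trans h3.symm)]
  · simp only [false_iff]
    rintro ⟨h1, h2, h3⟩
    exact h ⟨w, State.mem_layer.2 ⟨h1, h2⟩, h3⟩

theorem State.getAnchor_isSome {s : State c Block} {r : ℕ} :
    (s.getAnchor r).isSome ↔ ∃ v ∈ s.layer r, v.source = s.schedule.leader r := by
  unfold State.getAnchor
  split_ifs with h <;> simp [h]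

/-! ### Anchors with a quorum of votes -/

/-- The vertex `w` of the DAG `d` is an anchor of the schedule `S` that can be committed: some
vertex of round `w.round + 2` points to `f + 1` vertices that point to `w`. -/
def Supported (d : Finset (Vertex c Block)) (S : Schedule c) (w : Vertex c Block) : Prop :=
  w ∈ d ∧ w.source = S.leader w.round ∧ Even w.round ∧ ∃ v ∈ d, v.round = w.round + 2 ∧
    c.f + 1 ≤ ((d.filter fun u => u.round = w.round + 1).filter fun u =>
      u.source ∈ v.edges ∧ Path d u w).card

theorem Supported.mono {d D : Finset (Vertex c Block)} (h : d ⊆ D) {S : Schedule c}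
    {w : Vertex c Block} (hw : Supported d S w) : Supported D S w := by
  obtain ⟨h1, h2, h3, v, hv, hr, hc⟩ := hw
  refine ⟨h h1, h2, h3, v, h hv, hr, hc.trans (Finset.card_le_card fun u hu => ?_)⟩
  simp only [Finset.mem_filter] at hu ⊢
  exact ⟨⟨h hu.1.1, hu.1.2⟩, hu.2.1, hu.2.2.mono h⟩

theorem committable_iff {s : State c Block} (hd : IsDag s.dag) {r : ℕ} :
    Committable s r ↔
      s.lastOrderedRound < r ∧ ∃ w, w.round = r ∧ Supported s.dag s.schedule w := by
  constructor
  · rintro ⟨he, hl, w, hw, v, hv, hc⟩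
    obtain ⟨h1, rfl, h3⟩ := (State.getAnchor_eq_some hd).1 hw
    have hv := State.mem_layer.1 hv
    exact ⟨hl, w, rfl, h1, h3, he, v, hv.1, hv.2, hc⟩
  · rintro ⟨hl, w, rfl, h1, h3, he, v, hv, hr, hc⟩
    exact ⟨he, hl, w, (State.getAnchor_eq_some hd).2 ⟨h1, rfl, h3⟩, v,
      State.mem_layer.2 ⟨hv, hr⟩, hc⟩

/-- Quorum intersection: a vertex with `n - f` edges points to one of any `f + 1` voters.  Hence
all vertices at least two rounds above a supported anchor have it in their causal history. -/
theorem Supported.path {d : Finset (Vertex c Block)} (hd : IsDag d) (hf : 3 * c.f < c.n)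
    {S : Schedule c} {w : Vertex c Block} (hw : Supported d S w) {v : Vertex c Block}
    (hv : v ∈ d) (hr : w.round + 2 ≤ v.round) : Path d v w := by
  obtain ⟨-, -, -, x, -, -, hc⟩ := hw
  induction k : v.round - (w.round + 2) generalizing v with
  | zero =>
    set V := (d.filter fun u => u.round = w.round + 1).filter fun u =>
      u.source ∈ x.edges ∧ Path d u w with hV
    have hVm : ∀ u ∈ V, u ∈ d ∧ u.round = w.round + 1 ∧ Path d u w := by
      intro u hu
      simp only [hV, Finset.mem_filter] at hu
      exact ⟨hu.1.1, hu.1.2, hu.2.2⟩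
    have hcard : (V.image Vertex.source).card = V.card :=
      Finset.card_image_of_injOn fun u hu u' hu' h =>
        hd.inj u (hVm u hu).1 u' (hVm u' hu').1 ((hVm u hu).2.1.trans (hVm u' hu').2.1.symm) h
    have he := hd.card_edges v hv (by omega)
    have hne : (V.image Vertex.source ∩ v.edges).Nonempty := by
      rw [← Finset.card_pos]
      have h1 := Finset.card_union_add_card_inter (V.image Vertex.source) v.edges
      have h2 := Finset.card_le_univ (V.image Vertex.source ∪ v.edges)
      rw [Fintype.card_fin] at h2
      omega
    obtain ⟨q, hq⟩ := hne
    obtain ⟨hq1, hq2⟩ := Finset.mem_inter.1 hq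
    obtain ⟨u, hu, rfl⟩ := Finset.mem_image.1 hq1
    have := hVm u hu
    exact Relation.ReflTransGen.head ⟨this.1, by omega, hq2⟩ this.2.2
  | succ k ih =>
    have he := hd.card_edges v hv (by omega)
    obtain ⟨q, hq⟩ := Finset.card_pos.1 (show 0 < v.edges.card by omega)
    obtain ⟨u, hu, hur, hus⟩ := hd.closed v hv q hq
    exact Relation.ReflTransGen.head ⟨hu, hur, hus ▸ hq⟩ (ih hu (by omega) (by omega))

/-! ### The anchor at which a schedule ends -/

/-- The first round in which an anchor chosen by `S` can change the schedule.  The new schedule is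
only applied above its initial round, so that it lasts for one round at least even if `T = 0`. -/
def Schedule.threshold (S : Schedule c) : ℕ := S.initialRound + max c.T 1

/-- Walks back from `a` through the rounds `r, r - 2, …`, moving to each anchor of `S` that can be
reached from the current vertex, and stops below round `S.threshold`. -/
noncomputable def lowestAnchor (d : Finset (Vertex c Block)) (S : Schedule c) :
    ℕ → Vertex c Block → Vertex c Block
  | 0, a => a
  | 1, a => a
  | r + 2, a =>
    if h : S.threshold ≤ r + 2 ∧
        ∃ b ∈ d, b.round = r + 2 ∧ b.source = S.leader (r + 2) ∧ Path d a b then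
      lowestAnchor d S r h.2.choose
    else lowestAnchor d S r a

theorem lowestAnchor_of_path {d : Finset (Vertex c Block)} (hd : IsDag d) {S : Schedule c}
    {r : ℕ} {a b : Vertex c Block} (hr : S.threshold ≤ r + 2) (hb : b ∈ d)
    (hbr : b.round = r + 2) (hbs : b.source = S.leader (r + 2)) (hp : Path d a b) :
    lowestAnchor d S (r + 2) a = lowestAnchor d S r b := by
  have h : S.threshold ≤ r + 2 ∧
      ∃ b ∈ d, b.round = r + 2 ∧ b.source = S.leader (r + 2) ∧ Path d a b :=
    ⟨hr, b, hb, hbr, hbs, hp⟩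
  have hc := h.2.choose_spec
  rw [lowestAnchor, dif_pos h,
    hd.inj _ hc.1 b hb (hc.2.1.trans hbr.symm) (hc.2.2.1.trans hbs.symm)]

theorem lowestAnchor_of_not {d : Finset (Vertex c Block)} {S : Schedule c}
    {r : ℕ} {a : Vertex c Block} (h : ¬ (S.threshold ≤ r + 2 ∧
      ∃ b ∈ d, b.round = r + 2 ∧ b.source = S.leader (r + 2) ∧ Path d a b)) :
    lowestAnchor d S (r + 2) a = lowestAnchor d S r a := by
  rw [lowestAnchor, dif_neg h]

theorem lowestAnchor_of_lt (d : Finset (Vertex c Block)) (S : Schedule c) :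
    ∀ (r : ℕ) (a : Vertex c Block), r < S.threshold → lowestAnchor d S r a = a
  | 0, _, _ => rfl
  | 1, _, _ => rfl
  | r + 2, a, h => by
    rw [lowestAnchor_of_not (by omega), lowestAnchor_of_lt d S r a (by omega)]

theorem lowestAnchor_mem {d : Finset (Vertex c Block)} (S : Schedule c) :
    ∀ (r : ℕ) {a : Vertex c Block}, a ∈ d → S.threshold ≤ a.round →
      lowestAnchor d S r a ∈ d ∧ S.threshold ≤ (lowestAnchor d S r a).round
  | 0, _, ha, hr => ⟨ha, hr⟩
  | 1, _, ha, hr => ⟨ha, hr⟩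
  | r + 2, a, ha, hr => by
    rw [lowestAnchor]
    split_ifs with h
    · have hc := h.2.choose_spec
      exact lowestAnchor_mem S r hc.1 (h.1.trans hc.2.1.ge)
    · exact lowestAnchor_mem S r ha hr

theorem lowestAnchor_congr {d D : Finset (Vertex c Block)} (hd : IsDag d) (hD : IsDag D)
    (h : d ⊆ D) (S : Schedule c) : ∀ (r : ℕ) {a : Vertex c Block}, a ∈ d →
      lowestAnchor d S r a = lowestAnchor D S r a
  | 0, _, _ => rfl
  | 1, _, _ => rfl
  | r + 2, a, ha => by
    by_cases hb : S.threshold ≤ r + 2 ∧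
        ∃ b ∈ d, b.round = r + 2 ∧ b.source = S.leader (r + 2) ∧ Path d a b
    · obtain ⟨hr, b, hb, hbr, hbs, hp⟩ := hb
      rw [lowestAnchor_of_path hd hr hb hbr hbs hp,
        lowestAnchor_of_path hD hr (h hb) hbr hbs (hp.mono h), lowestAnchor_congr hd hD h S r hb]
    · rw [lowestAnchor_of_not hb, lowestAnchor_of_not, lowestAnchor_congr hd hD h S r ha]
      rintro ⟨hr, b, -, hbr, hbs, hp⟩
      have hp := (hd.path_iff hD h ha).1 hp
      exact hb ⟨hr, b, hp.mem ha, hbr, hbs, hp⟩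

/-- Every walk back from far enough above a supported anchor passes through that anchor. -/
theorem Supported.lowestAnchor_eq {d : Finset (Vertex c Block)} (hd : IsDag d)
    (hf : 3 * c.f < c.n) {S : Schedule c} {w : Vertex c Block} (hw : Supported d S w)
    (ht : S.threshold ≤ w.round) : ∀ (r : ℕ) {a : Vertex c Block}, a ∈ d → r + 2 ≤ a.round →
      Even r → w.round ≤ r → lowestAnchor d S r a = lowestAnchor d S (w.round - 2) w
  | 0, _, _, _, _, hwr => by unfold Schedule.threshold at ht; omega
  | 1, _, _, _, he, _ => absurd he (by decide)
  | r + 2, a, ha, har, he, hwr => by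
    rcases hwr.eq_or_lt with hwr | hwr
    · rw [lowestAnchor_of_path hd (by omega) hw.1 hwr (hwr ▸ hw.2.1)
        (hw.path hd hf ha (by omega)), show w.round - 2 = r by omega]
    · have her : Even r := by rw [Nat.even_add] at he; exact he.2 (by decide)
      have hwr' : w.round ≤ r := by
        obtain ⟨i, hi⟩ := hw.2.2.1
        obtain ⟨j, hj⟩ := her
        omega
      rw [lowestAnchor]
      split_ifs with h
      · have hc := h.2.choose_spec
        exact hw.lowestAnchor_eq hd hf ht r hc.1 hc.2.1.ge her hwr'
      · exact hw.lowestAnchor_eq hd hf ht r ha (by omega) her hwr'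

theorem Supported.lowestAnchor_unique {d : Finset (Vertex c Block)} (hd : IsDag d)
    (hf : 3 * c.f < c.n) {S : Schedule c} {w w' : Vertex c Block} (hw : Supported d S w)
    (hw' : Supported d S w') (ht : S.threshold ≤ w.round) (ht' : S.threshold ≤ w'.round) :
    lowestAnchor d S (w.round - 2) w = lowestAnchor d S (w'.round - 2) w' := by
  wlog h : w.round ≤ w'.round generalizing w w'
  · exact (this hw' hw ht' ht (by omega)).symm
  rcases h.eq_or_lt with h | h
  · rw [hd.inj w hw.1 w' hw'.1 h (by rw [hw.2.1, hw'.2.1, h])]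
  · obtain ⟨i, hi⟩ := hw.2.2.1
    obtain ⟨j, hj⟩ := hw'.2.2.1
    have : 1 ≤ S.threshold := by unfold Schedule.threshold; omega
    exact (hw.lowestAnchor_eq hd hf ht _ hw'.1 (by omega) ⟨j - 1, by omega⟩ (by omega)).symm

/-! ### The sequence of schedules that a DAG determines -/

/-- The schedule that follows `S` when it is changed at the anchor `a` of the DAG `d`. -/
def Schedule.next (P : Protocol c Block) (d : Finset (Vertex c Block)) (S : Schedule c)
    (a : Vertex c Block) : Schedule c where
  index := S.index + 1
  initialRound := a.round
  leader := P.nextLeader S a {v | Path d a v}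

/-- The schedules that a party whose DAG is a part of `d` can pass through. -/
inductive Chain (P : Protocol c Block) (d : Finset (Vertex c Block)) : Schedule c → Prop
  | initial : Chain P d ⟨0, 0, P.initialLeader⟩
  | next {S : Schedule c} {w : Vertex c Block} : Chain P d S → Supported d S w →
      S.threshold ≤ w.round → Chain P d (S.next P d (lowestAnchor d S (w.round - 2) w))

/-- Agreement: a DAG determines at most one schedule of each number. -/
theorem Chain.unique {P : Protocol c Block} {d : Finset (Vertex c Block)} (hd : IsDag d)
    (hf : 3 * c.f < c.n) {S S' : Schedule c} (h : Chain P d S) (h' : Chain P d S')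
    (hi : S.index = S'.index) : S = S' := by
  induction h generalizing S' with
  | initial =>
    cases h' with
    | initial => rfl
    | next => simp [Schedule.next] at hi
  | next hS hw ht ih =>
    cases h' with
    | initial => simp [Schedule.next] at hi
    | next hS' hw' ht' =>
      obtain rfl := ih hS' (by simpa [Schedule.next] using hi)
      rw [hw.lowestAnchor_unique hd hf hw' ht ht']

/-! ### Effect of the commit rule -/

/-- The two states differ at most in what the commit rule writes. -/
structure SameDag (s s' : State c Block) : Prop where
  self : s'.self = s.self
  inbox : s'.inbox = s.inbox
  sent : s'.sent = s.sent
  delivered : s'.delivered = s.delivered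
  buffer : s'.buffer = s.buffer
  dag : s'.dag = s.dag
  round : s'.round = s.round
  elapsed : s'.elapsed = s.elapsed

theorem SameDag.refl (s : State c Block) : SameDag s s := by
  constructor <;> rfl

theorem SameDag.trans {s s' s'' : State c Block} (h : SameDag s s') (h' : SameDag s' s'') :
    SameDag s s'' :=
  ⟨h'.1.trans h.1, h'.2.trans h.2, h'.3.trans h.3, h'.4.trans h.4, h'.5.trans h.5,
    h'.6.trans h.6, h'.7.trans h.7, h'.8.trans h.8⟩

theorem orderHistory_sameDag (P : Protocol c Block) (l : List (Vertex c Block))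
    (s : State c Block) : SameDag s (orderHistory P s l) := by
  induction l generalizing s with
  | nil => exact .refl _
  | cons a l ih =>
    rw [orderHistory]
    split_ifs
    · constructor <;> rfl
    · exact SameDag.trans (by constructor <;> rfl) (ih _)

theorem commitStep_sameDag (P : Protocol c Block) (s : State c Block) :
    SameDag s (commitStep P s) := by
  unfold commitStep
  split_ifs
  · split
    · exact SameDag.trans (by constructor <;> rfl) (orderHistory_sameDag P _ _)
    · exact .refl _
  · exact .refl _

theorem commitAll_sameDag (P : Protocol c Block) (s : State c Block) :
    SameDag s (commitAll P s) := by
  unfold commitAll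
  generalize s.dag.card = k
  induction k with
  | zero => exact .refl _
  | succ k ih =>
    rw [Function.iterate_succ_apply']
    exact ih.trans (commitStep_sameDag P _)

theorem orderHistory_schedule (P : Protocol c Block) (l : List (Vertex c Block))
    (s : State c Block) :
    (∀ a, l.find? (fun a => decide (s.schedule.initialRound + c.T ≤ a.round)) = some a →
      (orderHistory P s l).schedule = s.schedule.next P s.dag a ∧
        (orderHistory P s l).lastOrderedRound = a.round) ∧
    (l.find? (fun a => decide (s.schedule.initialRound + c.T ≤ a.round)) = none →
      (orderHistory P s l).schedule = s.schedule ∧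
        (orderHistory P s l).lastOrderedRound = s.lastOrderedRound) := by
  induction l generalizing s with
  | nil => simp [orderHistory]
  | cons a l ih =>
    rw [orderHistory]
    split_ifs with h
    · rw [List.find?_cons_of_pos (by simpa using h)]
      refine ⟨fun b hb => ?_, by simp⟩
      obtain rfl := Option.some.inj hb
      exact ⟨rfl, rfl⟩
    · rw [List.find?_cons_of_neg (by simpa using h)]
      exact ih { s with
        ordered := s.ordered ∪ s.dag.filter fun v => 0 < v.round ∧ Path s.dag a v }

theorem collectAnchors_eq_append {s : State c Block} (hd : IsDag s.dag) :
    ∀ (r : ℕ) (a : Vertex c Block) (l : List (Vertex c Block)),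
      ∃ l', collectAnchors s r a l = l' ++ l ∧
        ∀ b ∈ l', s.lastOrderedRound < b.round ∧ b.round ≤ r
  | 0, _, _ => ⟨[], rfl, by simp⟩
  | 1, _, _ => ⟨[], rfl, by simp⟩
  | r + 2, a, l => by
    rw [collectAnchors]
    split_ifs with h
    · cases hb : s.getAnchor (r + 2) with
      | none =>
        obtain ⟨l', h1, h2⟩ := collectAnchors_eq_append hd r a l
        exact ⟨l', h1, fun b hb => ⟨(h2 b hb).1, (h2 b hb).2.trans (by omega)⟩⟩
      | some b =>
        have hbr := ((State.getAnchor_eq_some hd).1 hb).2.1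
        dsimp only
        split_ifs
        · obtain ⟨l', h1, h2⟩ := collectAnchors_eq_append hd r b (b :: l)
          refine ⟨l' ++ [b], by simp [h1], fun x hx => ?_⟩
          rcases List.mem_append.1 hx with hx | hx
          · exact ⟨(h2 x hx).1, (h2 x hx).2.trans (by omega)⟩
          · rw [List.mem_singleton.1 hx]
            omega
        · obtain ⟨l', h1, h2⟩ := collectAnchors_eq_append hd r a l
          exact ⟨l', h1, fun b hb => ⟨(h2 b hb).1, (h2 b hb).2.trans (by omega)⟩⟩
    · exact ⟨[], rfl, by simp⟩

/-- Anchors below the threshold, which depend on what a party has ordered before, come first in the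
stack; the first collected anchor that reaches the threshold does not depend on them. -/
theorem find_collectAnchors {s : State c Block} (hd : IsDag s.dag)
    (hl : s.lastOrderedRound < s.schedule.threshold) :
    ∀ (r : ℕ) (a : Vertex c Block) (l : List (Vertex c Block)),
      s.schedule.threshold ≤ a.round →
      (collectAnchors s r a (a :: l)).find? (fun b => decide (s.schedule.threshold ≤ b.round)) =
        some (lowestAnchor s.dag s.schedule r a)
  | 0, a, l, ha => by simp [collectAnchors, lowestAnchor, ha]
  | 1, a, l, ha => by simp [collectAnchors, lowestAnchor, ha]
  | r + 2, a, l, ha => by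
    by_cases hr : s.schedule.threshold ≤ r + 2
    · rw [collectAnchors, if_pos (by omega)]
      cases hb : s.getAnchor (r + 2) with
      | none =>
        rw [lowestAnchor_of_not]
        · exact find_collectAnchors hd hl r a l ha
        · rintro ⟨-, b, h1, h2, h3, -⟩
          rw [(State.getAnchor_eq_some hd).2 ⟨h1, h2, h3⟩] at hb
          cases hb
      | some b =>
        obtain ⟨h1, h2, h3⟩ := (State.getAnchor_eq_some hd).1 hb
        dsimp only
        split_ifs with hp
        · rw [lowestAnchor_of_path hd hr h1 h2 h3 hp]
          exact find_collectAnchors hd hl r b (a :: l) (h2 ▸ hr)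
        · rw [lowestAnchor_of_not]
          · exact find_collectAnchors hd hl r a l ha
          · rintro ⟨-, b', h1', h2', h3', hp'⟩
            rw [hd.inj b' h1' b h1 (h2'.trans h2.symm) (h3'.trans h3.symm)] at hp'
            exact hp hp'
    · obtain ⟨l', h1, h2⟩ := collectAnchors_eq_append hd (r + 2) a (a :: l)
      rw [lowestAnchor_of_lt _ _ _ _ (by omega), h1, List.find?_append,
        List.find?_eq_none.2 fun b hb => by have := h2 b hb; simp; omega]
      simp [ha]

/-- The bookkeeping of the commit rule between two commits. -/
structure OrderInv (s : State c Block) : Prop where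
  le_last : s.schedule.initialRound ≤ s.lastOrderedRound
  last_lt : s.lastOrderedRound < s.schedule.threshold
  exists_initial : ∃ v ∈ s.dag, v.round = s.schedule.initialRound

theorem orderAnchors_spec (P : Protocol c Block) {s : State c Block} (hd : IsDag s.dag)
    (hs : OrderInv s) {w : Vertex c Block} (hw : s.lastOrderedRound < w.round) :
    (w.round < s.schedule.threshold ∧ (orderAnchors P s w).schedule = s.schedule ∧
      (orderAnchors P s w).lastOrderedRound = w.round) ∨
    (s.schedule.threshold ≤ w.round ∧
      (orderAnchors P s w).schedule =
        s.schedule.next P s.dag (lowestAnchor s.dag s.schedule (w.round - 2) w) ∧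
      (orderAnchors P s w).lastOrderedRound =
        (lowestAnchor s.dag s.schedule (w.round - 2) w).round) := by
  obtain ⟨l', h1, h2⟩ := collectAnchors_eq_append hd (w.round - 2) w [w]
  have hle := hs.le_last
  have hmem : ∀ b ∈ collectAnchors s (w.round - 2) w [w],
      s.lastOrderedRound < b.round ∧ b.round ≤ w.round := by
    intro b hb
    rw [h1] at hb
    rcases List.mem_append.1 hb with hb | hb
    · exact ⟨(h2 b hb).1, (h2 b hb).2.trans (by omega)⟩
    · rw [List.mem_singleton.1 hb]
      exact ⟨hw, le_rfl⟩
  -- All collected rounds exceed the initial one, so `T` may be replaced by `max T 1`.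
  have hfind : (collectAnchors s (w.round - 2) w [w]).find?
      (fun a => decide (s.schedule.initialRound + c.T ≤ a.round)) =
      (collectAnchors s (w.round - 2) w [w]).find?
        (fun a => decide (s.schedule.threshold ≤ a.round)) := by
    generalize collectAnchors s (w.round - 2) w [w] = l at hmem
    induction l with
    | nil => rfl
    | cons b l ih =>
      have hb := (hmem b (by simp)).1
      rw [List.find?_cons, List.find?_cons, ih fun x hx => hmem x (by simp [hx])]
      congr 1
      unfold Schedule.threshold
      rw [decide_eq_decide]
      omega
  have key := orderHistory_schedule P (collectAnchors s (w.round - 2) w [w])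
    { s with lastOrderedRound := w.round }
  unfold orderAnchors
  by_cases ht : s.schedule.threshold ≤ w.round
  · have hsome := find_collectAnchors hd hs.last_lt (w.round - 2) w [] ht
    exact .inr ⟨ht, key.1 _ (hfind.trans hsome)⟩
  · refine .inl ⟨by omega, key.2 (hfind.trans ?_)⟩
    rw [List.find?_eq_none]
    intro b hb
    have := hmem b hb
    simp
    omega

theorem commitStep_of_not {P : Protocol c Block} {s : State c Block}
    (h : ¬ ∃ r, Committable s r) : commitStep P s = s := dif_neg h

theorem commitStep_of_exists (P : Protocol c Block) {s : State c Block} (hd : IsDag s.dag)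
    (h : ∃ r, Committable s r) : ∃ w, Supported s.dag s.schedule w ∧
      s.lastOrderedRound < w.round ∧ commitStep P s = orderAnchors P s w := by
  have hr := Nat.find_spec h
  obtain ⟨hl, w, hwr, hw⟩ := (committable_iff hd).1 hr
  refine ⟨w, hw, hwr ▸ hl, ?_⟩
  have : s.getAnchor (Nat.find h) = some w :=
    (State.getAnchor_eq_some hd).2 ⟨hw.1, hwr, hwr ▸ hw.2.1⟩
  rw [commitStep, dif_pos h, this]

/-- A commit passes a further vertex of the DAG. -/
theorem commitStep_spec (P : Protocol c Block) {s : State c Block} (hd : IsDag s.dag)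
    (hs : OrderInv s) (h : ∃ r, Committable s r) :
    OrderInv (commitStep P s) ∧ s.lastOrderedRound < (commitStep P s).lastOrderedRound ∧
      ∃ v ∈ s.dag, v.round = (commitStep P s).lastOrderedRound := by
  obtain ⟨w, hw, hl, he⟩ := commitStep_of_exists P hd h
  have hle := hs.le_last
  have hdag := (commitStep_sameDag P s).dag
  rw [he] at hdag ⊢
  rcases orderAnchors_spec P hd hs hl with ⟨ht, h1, h2⟩ | ⟨ht, h1, h2⟩
  · refine ⟨⟨?_, ?_, ?_⟩, ?_, w, hw.1, h2.symm⟩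
    · rw [h1, h2]; omega
    · rw [h1, h2]; exact ht
    · rw [h1, hdag]; exact hs.exists_initial
    · rw [h2]; exact hl
  · obtain ⟨hm, hr⟩ := lowestAnchor_mem s.schedule (w.round - 2) hw.1 ht
    refine ⟨⟨?_, ?_, ?_⟩, ?_, _, hm, h2.symm⟩
    · rw [h1, h2]; exact le_rfl
    · rw [h1, h2]
      simp only [Schedule.threshold, Schedule.next]
      omega
    · rw [h1, hdag]; exact ⟨_, hm, rfl⟩
    · rw [h2]; exact hs.last_lt.trans_le hr

theorem commitStep_chain {P : Protocol c Block} {s : State c Block} (hd : IsDag s.dag)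
    (hs : OrderInv s) {D : Finset (Vertex c Block)} (hD : IsDag D) (hsub : s.dag ⊆ D)
    (hch : Chain P D s.schedule) : Chain P D (commitStep P s).schedule := by
  by_cases h : ∃ r, Committable s r
  · obtain ⟨w, hw, hl, he⟩ := commitStep_of_exists P hd h
    rw [he]
    rcases orderAnchors_spec P hd hs hl with ⟨ht, h1, -⟩ | ⟨ht, h1, -⟩
    · rwa [h1]
    · have hm := (lowestAnchor_mem s.schedule (w.round - 2) hw.1 ht).1
      have : s.schedule.next P s.dag (lowestAnchor s.dag s.schedule (w.round - 2) w) =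
          s.schedule.next P D (lowestAnchor D s.schedule (w.round - 2) w) := by
        rw [← lowestAnchor_congr hd hD hsub _ _ hw.1]
        unfold Schedule.next
        simp only [hd.path_iff hD hsub hm]
      rw [h1, this]
      exact hch.next (hw.mono hsub) ht
  · rwa [commitStep_of_not h]

theorem commitStep_schedule {P : Protocol c Block} {s : State c Block} (hd : IsDag s.dag)
    (hs : OrderInv s) : (commitStep P s).schedule = s.schedule ∨
      s.schedule.index < (commitStep P s).schedule.index := by
  by_cases h : ∃ r, Committable s r
  · obtain ⟨w, -, hl, he⟩ := commitStep_of_exists P hd h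
    rw [he]
    rcases orderAnchors_spec P hd hs hl with ⟨-, h1, -⟩ | ⟨-, h1, -⟩ <;> rw [h1]
    · exact .inl rfl
    · exact .inr (Nat.lt_succ_self _)
  · exact .inl (by rw [commitStep_of_not h])

/-- The number of vertices that the commit rule has not yet passed. -/
noncomputable def State.unpassed (s : State c Block) : ℕ :=
  (s.dag.filter fun v => s.lastOrderedRound < v.round).card

/-- `commitAll` leaves nothing to commit. -/
theorem commitAll_spec (P : Protocol c Block) {s : State c Block} (hd : IsDag s.dag)
    (hs : OrderInv s) :
    OrderInv (commitAll P s) ∧ (∀ r, ¬ Committable (commitAll P s) r) ∧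
      ((commitAll P s).schedule = s.schedule ∨
        s.schedule.index < (commitAll P s).schedule.index) ∧
      ∀ D, IsDag D → s.dag ⊆ D → Chain P D s.schedule → Chain P D (commitAll P s).schedule := by
  unfold commitAll
  have hk : s.unpassed ≤ s.dag.card := Finset.card_filter_le _ _
  generalize s.dag.card = k at hk
  induction k generalizing s with
  | zero =>
    refine ⟨hs, fun r hr => ?_, .inl rfl, fun _ _ _ h => h⟩
    obtain ⟨hl, w, rfl, hw⟩ := (committable_iff hd).1 hr
    have : w ∈ s.dag.filter fun v => s.lastOrderedRound < v.round :=
      Finset.mem_filter.2 ⟨hw.1, hl⟩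
    rw [Finset.card_eq_zero.1 (Nat.le_zero.1 hk)] at this
    simp at this
  | succ k ih =>
    rw [Function.iterate_succ_apply]
    have hdag := (commitStep_sameDag P s).dag
    by_cases h : ∃ r, Committable s r
    · obtain ⟨h1, h2, v, hv, hvr⟩ := commitStep_spec P hd hs h
      have hlt : (commitStep P s).unpassed < s.unpassed := by
        refine Finset.card_lt_card (Finset.ssubset_iff_subset_ne.2 ⟨fun u hu => ?_, fun e => ?_⟩)
        · rw [hdag] at hu
          simp only [Finset.mem_filter] at hu ⊢
          exact ⟨hu.1, by omega⟩
        · have : v ∈ s.dag.filter fun v => s.lastOrderedRound < v.round :=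
            Finset.mem_filter.2 ⟨hv, by omega⟩
          rw [← e] at this
          have := (Finset.mem_filter.1 this).2
          omega
      obtain ⟨i1, i2, i3, i4⟩ := ih (by rwa [hdag]) h1 (by omega)
      refine ⟨i1, i2, ?_, fun D hD hsub hch => ?_⟩
      · rcases i3 with i3 | i3 <;> rcases commitStep_schedule (P := P) hd hs with i5 | i5
        · exact .inl (i3.trans i5)
        · exact .inr (i5.trans_eq (by rw [i3]))
        · exact .inr (i5 ▸ i3)
        · exact .inr (i5.trans i3)
      exact i4 D hD (by rwa [hdag]) (commitStep_chain hd hs hD hsub hch)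
    · rw [commitStep_of_not h]
      have : (commitStep P)^[k] s = s := Function.iterate_fixed (commitStep_of_not h) k
      rw [this]
      exact ⟨hs, fun r hr => h ⟨r, hr⟩, .inl rfl, fun _ _ _ h => h⟩

/-- Catching up: a party whose DAG determines the schedule `S`, and which has nothing to commit,
has advanced at least to `S`. -/
theorem Chain.index_le {P : Protocol c Block} {s : State c Block} (hd : IsDag s.dag)
    (hf : 3 * c.f < c.n) (hs : OrderInv s) (hset : ∀ r, ¬ Committable s r)
    (hch : Chain P s.dag s.schedule) {S : Schedule c} (h : Chain P s.dag S) :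
    S.index ≤ s.schedule.index := by
  induction h with
  | initial => exact Nat.zero_le _
  | @next S w hS hw ht ih =>
    rcases ih.lt_or_eq with h | h
    · exact h
    · obtain rfl := hS.unique hd hf hch h
      exact absurd ((committable_iff hd).2 ⟨hs.last_lt.trans_le ht, w, rfl, hw⟩) (hset _)

/-! ### The elementary transitions of a party -/

/-- The elementary transitions, other than the passing of time, that a step is composed of. -/
inductive Transition (P : Protocol c Block) : State c Block → State c Block → Prop
  | hear (s : State c Block) (x : Party c × Msg c Block) :
      Transition P s { s with inbox := insert x s.inbox }
  | echo (s : State c Block) (v : Vertex c Block) : (v.source, Msg.init v) ∈ s.inbox →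
      (∀ u, Msg.echo u ∈ s.sent → ¬ SameInstance u v) →
      Transition P s { s with sent := insert (Msg.echo v) s.sent }
  | ready (s : State c Block) (v : Vertex c Block) :
      (c.n + c.f < 2 * s.count (Msg.echo v) ∨ c.f + 1 ≤ s.count (Msg.ready v)) →
      Transition P s { s with sent := insert (Msg.ready v) s.sent }
  | deliver (s : State c Block) (v : Vertex c Block) : 2 * c.f + 1 ≤ s.count (Msg.ready v) →
      (∀ u ∈ s.delivered, ¬ SameInstance u v) → 1 ≤ v.round → c.n - c.f ≤ v.edges.card →
      Transition P s { s with delivered := insert v s.delivered, buffer := v :: s.buffer }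
  | discard (s : State c Block) (v : Vertex c Block) : 2 * c.f + 1 ≤ s.count (Msg.ready v) →
      (∀ u ∈ s.delivered, ¬ SameInstance u v) → ¬ (1 ≤ v.round ∧ c.n - c.f ≤ v.edges.card) →
      Transition P s { s with delivered := insert v s.delivered }
  | add (s : State c Block) (v : Vertex c Block) : v ∈ s.buffer → Addable s v →
      Transition P s (addToDag P { s with buffer := s.buffer.erase v } v)
  | advance (s : State c Block) : c.n - c.f ≤ (s.layer s.round).card →
      (Odd s.round ∨ (s.getAnchor s.round).isSome ∨ c.timeout ≤ s.elapsed) →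
      Transition P s (enterRound s (s.round + 1))

/-- A finite sequence of elementary transitions. -/
abbrev Transitions (P : Protocol c Block) : State c Block → State c Block → Prop :=
  Relation.ReflTransGen (Transition P)

theorem drainStep_transitions (P : Protocol c Block) (s : State c Block) :
    Transitions P s (drainStep P s) := by
  unfold drainStep
  split
  · next v hv =>
    exact .single (.add s v (List.mem_of_find?_eq_some hv) (by simpa using List.find?_some hv))
  · exact .refl

theorem drain_transitions (P : Protocol c Block) (s : State c Block) :
    Transitions P s (drain P s) := by
  unfold drain
  generalize s.buffer.length = k
  induction k with
  | zero => exact .refl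
  | succ k ih =>
    rw [Function.iterate_succ_apply']
    exact ih.trans (drainStep_transitions P _)

theorem tryEcho_transitions (P : Protocol c Block) (s : State c Block) (v : Vertex c Block) :
    Transitions P s (tryEcho s v) := by
  unfold tryEcho
  split_ifs with h
  · exact .single (.echo s v h.1 h.2)
  · exact .refl

theorem tryReady_transitions (P : Protocol c Block) (s : State c Block) (v : Vertex c Block) :
    Transitions P s (tryReady s v) := by
  unfold tryReady
  split_ifs with h
  · exact .single (.ready s v h.1)
  · exact .refl

theorem tryDeliver_transitions (P : Protocol c Block) (s : State c Block) (v : Vertex c Block) :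
    Transitions P s (tryDeliver P s v) := by
  unfold tryDeliver
  split_ifs with h h'
  · exact .head (.deliver s v h.1 h.2 h'.1 h'.2) (drain_transitions P _)
  · exact .single (.discard s v h.1 h.2 h')
  · exact .refl

theorem receive_transitions (P : Protocol c Block) (s : State c Block)
    (x : Party c × Msg c Block) : Transitions P s (receive P s x) :=
  .head (.hear s x) <| (tryEcho_transitions P _ _).trans <|
    (tryReady_transitions P _ _).trans (tryDeliver_transitions P _ _)

theorem foldl_receive_transitions (P : Protocol c Block) (l : List (Party c × Msg c Block))
    (s : State c Block) : Transitions P s (l.foldl (receive P) s) := by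
  induction l generalizing s with
  | nil => exact .refl
  | cons x l ih => exact (receive_transitions P s x).trans (ih _)

theorem tryAdvance_transitions (P : Protocol c Block) (s : State c Block) :
    Transitions P s (tryAdvance s) := by
  unfold tryAdvance
  split_ifs with h
  · exact .single (.advance s h.1 h.2)
  · exact .refl

/-- The three possible continuations after a vertex has been added to the DAG. -/
theorem addToDag_cases (P : Protocol c Block) (s : State c Block) (v : Vertex c Block) :
    let s' := commitAll P { s with dag := insert v s.dag }
    (s'.round < v.round ∧ c.n - c.f ≤ (s'.layer v.round).card ∧
      addToDag P s v = enterRound s' (v.round + 1)) ∨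
    (¬ (s'.round < v.round ∧ c.n - c.f ≤ (s'.layer v.round).card) ∧
      c.n - c.f ≤ (s'.layer s'.round).card ∧
      (Odd s'.round ∨ (s'.getAnchor s'.round).isSome ∨ c.timeout ≤ s'.elapsed) ∧
      addToDag P s v = enterRound s' (s'.round + 1)) ∨
    (¬ (s'.round < v.round ∧ c.n - c.f ≤ (s'.layer v.round).card) ∧
      ¬ (c.n - c.f ≤ (s'.layer s'.round).card ∧
        (Odd s'.round ∨ (s'.getAnchor s'.round).isSome ∨ c.timeout ≤ s'.elapsed)) ∧
      addToDag P s v = s') := by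
  intro s'
  by_cases h : s'.round < v.round ∧ c.n - c.f ≤ (s'.layer v.round).card
  · exact .inl ⟨h.1, h.2, if_pos h⟩
  · have e : addToDag P s v = tryAdvance s' := if_neg h
    rw [e]
    unfold tryAdvance
    split_ifs with h'
    · exact .inr (.inl ⟨h, h'.1, h'.2, rfl⟩)
    · exact .inr (.inr ⟨h, h', rfl⟩)

/-! ### Invariants of the local state -/

/-- Invariants of the broadcast of vertices and of the construction of the DAG. -/
structure DagInv (P : Protocol c Block) (s : State c Block) : Prop where
  genesis : ∀ q, ⟨0, q, P.genesisBlock, ∅⟩ ∈ s.dag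
  dag_origin : ∀ v ∈ s.dag, v = ⟨0, v.source, P.genesisBlock, ∅⟩ ∨
    (v ∈ s.delivered ∧ 1 ≤ v.round ∧ c.n - c.f ≤ v.edges.card)
  buffer_origin : ∀ v ∈ s.buffer, v ∈ s.delivered ∧ 1 ≤ v.round ∧ c.n - c.f ≤ v.edges.card
  delivered_inj : ∀ u ∈ s.delivered, ∀ v ∈ s.delivered, SameInstance u v → u = v
  kept : ∀ v ∈ s.delivered, 1 ≤ v.round → c.n - c.f ≤ v.edges.card → v ∈ s.dag ∨ v ∈ s.buffer
  closed : ∀ v ∈ s.dag, ∀ q ∈ v.edges, ∃ u ∈ s.dag, u.round + 1 = v.round ∧ u.source = q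
  round_pos : 1 ≤ s.round
  layer_below : c.n - c.f ≤ (s.layer (s.round - 1)).card
  init_spec : ∀ v, Msg.init v ∈ s.sent → v.source = s.self ∧ 1 ≤ v.round ∧ v.round ≤ s.round ∧
    c.n - c.f ≤ v.edges.card ∧ ∀ q ∈ v.edges, ∃ u ∈ s.dag, u.round + 1 = v.round ∧ u.source = q
  init_inj : ∀ u v, Msg.init u ∈ s.sent → Msg.init v ∈ s.sent → u.round = v.round → u = v
  init_current : ∃ v, Msg.init v ∈ s.sent ∧ v.round = s.round
  init_even : ∀ r, Even r → 0 < r → r ≤ s.round → ∃ v, Msg.init v ∈ s.sent ∧ v.round = r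

/-- A party has moved to every round with `n - f` vertices, and past it if the round is odd. -/
def RoundInv (s : State c Block) : Prop :=
  ∀ r, c.n - c.f ≤ (s.layer r).card → r ≤ s.round ∧ (Odd r → r < s.round)

/-- Invariants of reliable broadcast. -/
structure BroadcastInv (s : State c Block) : Prop where
  echo_spec : ∀ v, Msg.echo v ∈ s.sent → (v.source, Msg.init v) ∈ s.inbox
  echo_inj : ∀ u v, Msg.echo u ∈ s.sent → Msg.echo v ∈ s.sent → SameInstance u v → u = v
  ready_spec : ∀ v, Msg.ready v ∈ s.sent →
    c.n + c.f < 2 * s.count (Msg.echo v) ∨ c.f + 1 ≤ s.count (Msg.ready v)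
  delivered_spec : ∀ v ∈ s.delivered, 2 * c.f + 1 ≤ s.count (Msg.ready v)

/-- All invariants that hold after each elementary transition. -/
structure Inv (P : Protocol c Block) (s : State c Block) : Prop where
  dag : DagInv P s
  round : RoundInv s
  broadcast : BroadcastInv s
  order : OrderInv s
  settled : ∀ r, ¬ Committable s r

/-- What can be said about any later state `s'` of a party. -/
structure Later (P : Protocol c Block) (s s' : State c Block) : Prop where
  self : s'.self = s.self
  inbox : s.inbox ⊆ s'.inbox
  sent : s.sent ⊆ s'.sent
  delivered : s.delivered ⊆ s'.delivered
  dag : s.dag ⊆ s'.dag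
  round : s.round ≤ s'.round
  schedule : s'.schedule = s.schedule ∨ s.schedule.index < s'.schedule.index
  chain : ∀ D, IsDag D → s'.dag ⊆ D → Chain P D s.schedule → Chain P D s'.schedule

theorem Later.refl (P : Protocol c Block) (s : State c Block) : Later P s s :=
  ⟨rfl, subset_rfl, subset_rfl, subset_rfl, subset_rfl, le_rfl, .inl rfl, fun _ _ _ h => h⟩

theorem Later.index {P : Protocol c Block} {s s' : State c Block} (h : Later P s s') :
    s.schedule.index ≤ s'.schedule.index := by
  rcases h.schedule with h | h
  · rw [h]
  · exact h.le

theorem Later.trans {P : Protocol c Block} {s s' s'' : State c Block} (h : Later P s s')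
    (h' : Later P s' s'') : Later P s s'' :=
  ⟨h'.self.trans h.self, h.inbox.trans h'.inbox, h.sent.trans h'.sent,
    h.delivered.trans h'.delivered, h.dag.trans h'.dag, h.round.trans h'.round,
    h'.schedule.elim
      (fun e => h.schedule.imp (fun e' => e.trans e') fun hlt => e ▸ hlt)
      fun hlt => .inr (h.index.trans_lt hlt),
    fun D hD hs hc => h'.chain D hD hs (h.chain D hD (h'.dag.trans hs) hc)⟩

theorem DagInv.isDag {P : Protocol c Block} {s : State c Block} (h : DagInv P s) :
    IsDag s.dag where
  inj u hu v hv hr hs := by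
    rcases h.dag_origin u hu with hu' | hu' <;> rcases h.dag_origin v hv with hv' | hv'
    · rw [hu', hv', hs]
    · rw [hu'] at hr
      have := hv'.2.1
      simp only at hr
      omega
    · rw [hv'] at hr
      have := hu'.2.1
      simp only at hr
      omega
    · exact h.delivered_inj u hu'.1 v hv'.1 ⟨hr, hs⟩
  closed := h.closed
  card_edges v hv hr := by
    rcases h.dag_origin v hv with hv' | hv'
    · rw [hv'] at hr
      simp at hr
    · exact hv'.2.2

theorem layer_subset {s s' : State c Block} (h : s.dag ⊆ s'.dag) (r : ℕ) :
    s.layer r ⊆ s'.layer r := Finset.filter_subset_filter _ h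

theorem count_mono {s s' : State c Block} (h : s.inbox ⊆ s'.inbox) (m : Msg c Block) :
    s.count m ≤ s'.count m :=
  Finset.card_le_card (Finset.monotone_filter_right _ fun _ _ hq => h hq)

theorem DagInv.congr {P : Protocol c Block} {s s' : State c Block} (e : SameDag s s')
    (h : DagInv P s) : DagInv P s' := by
  obtain ⟨⟩ := s
  obtain ⟨⟩ := s'
  obtain ⟨e1, e2, e3, e4, e5, e6, e7, e8⟩ := e
  dsimp only at e1 e2 e3 e4 e5 e6 e7 e8
  subst e1 e2 e3 e4 e5 e6 e7 e8
  exact ⟨h.1, h.2, h.3, h.4, h.5, h.6, h.7, h.8, h.9, h.10, h.11, h.12⟩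

theorem BroadcastInv.congr {s s' : State c Block} (e : SameDag s s')
    (h : BroadcastInv s) : BroadcastInv s' := by
  obtain ⟨⟩ := s
  obtain ⟨⟩ := s'
  obtain ⟨e1, e2, e3, e4, e5, e6, e7, e8⟩ := e
  dsimp only at e1 e2 e3 e4 e5 e6 e7 e8
  subst e1 e2 e3 e4 e5 e6 e7 e8
  exact ⟨h.1, h.2, h.3, h.4⟩

theorem DagInv.enterRound {P : Protocol c Block} {s : State c Block} (h : DagInv P s) {r : ℕ}
    (hr : s.round < r) (hl : c.n - c.f ≤ (s.layer (r - 1)).card)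
    (he : ∀ r', Even r' → s.round < r' → r' ≤ r → r' = r) : DagInv P (enterRound s r) where
  genesis := h.genesis
  dag_origin := h.dag_origin
  buffer_origin := h.buffer_origin
  delivered_inj := h.delivered_inj
  kept := h.kept
  closed := h.closed
  round_pos := by simp only [HammerHead.enterRound]; omega
  layer_below := hl
  init_spec v hv := by
    rcases Finset.mem_insert.1 hv with hv | hv
    · obtain rfl := Msg.init.inj hv
      refine ⟨rfl, by simp only; omega, le_rfl, ?_, fun q hq => ?_⟩
      · exact hl.trans (h.isDag.card_layer_sources (r - 1)).ge
      · obtain ⟨u, hu, rfl⟩ := Finset.mem_image.1 hq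
        have hu := State.mem_layer.1 hu
        exact ⟨u, hu.1, by simp only; omega, rfl⟩
    · obtain ⟨h1, h2, h3, h4⟩ := h.init_spec v hv
      exact ⟨h1, h2, h3.trans hr.le, h4⟩
  init_inj u v hu hv huv := by
    rcases Finset.mem_insert.1 hu with hu | hu <;> rcases Finset.mem_insert.1 hv with hv | hv
    · rw [Msg.init.inj hu, Msg.init.inj hv]
    · have := (h.init_spec v hv).2.2.1
      rw [Msg.init.inj hu] at huv
      simp only at huv
      omega
    · have := (h.init_spec u hu).2.2.1
      rw [Msg.init.inj hv] at huv
      simp only at huv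
      omega
    · exact h.init_inj u v hu hv huv
  init_current := ⟨_, Finset.mem_insert_self _ _, rfl⟩
  init_even r' hr' h0 hle := by
    by_cases hlt : r' ≤ s.round
    · obtain ⟨v, hv, hvr⟩ := h.init_even r' hr' h0 hlt
      exact ⟨v, Finset.mem_insert_of_mem hv, hvr⟩
    · exact ⟨_, Finset.mem_insert_self _ _, (he r' hr' (by omega) hle).symm⟩

theorem DagInv.insert {P : Protocol c Block} {s : State c Block} (h : DagInv P s)
    {v : Vertex c Block} (hv : v ∈ s.buffer) (ha : Addable s v) :
    DagInv P { s with buffer := s.buffer.erase v, dag := insert v s.dag } where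
  genesis q := Finset.mem_insert_of_mem (h.genesis q)
  dag_origin u hu := by
    rcases Finset.mem_insert.1 hu with rfl | hu
    · exact .inr (h.buffer_origin u hv)
    · exact h.dag_origin u hu
  buffer_origin u hu := h.buffer_origin u (List.mem_of_mem_erase hu)
  delivered_inj := h.delivered_inj
  kept u hu h1 h2 := by
    by_cases e : u = v
    · exact .inl (e ▸ Finset.mem_insert_self _ _)
    · exact (h.kept u hu h1 h2).imp Finset.mem_insert_of_mem (List.mem_erase_of_ne e).2
  closed u hu q hq := by
    rcases Finset.mem_insert.1 hu with rfl | hu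
    · obtain ⟨x, hx, hx'⟩ := ha q hq
      exact ⟨x, Finset.mem_insert_of_mem hx, hx'⟩
    · obtain ⟨x, hx, hx'⟩ := h.closed u hu q hq
      exact ⟨x, Finset.mem_insert_of_mem hx, hx'⟩
  round_pos := h.round_pos
  layer_below := h.layer_below.trans
    (Finset.card_le_card (layer_subset (Finset.subset_insert _ _) _))
  init_spec u hu := by
    obtain ⟨h1, h2, h3, h4, h5⟩ := h.init_spec u hu
    refine ⟨h1, h2, h3, h4, fun q hq => ?_⟩
    obtain ⟨x, hx, hx'⟩ := h5 q hq
    exact ⟨x, Finset.mem_insert_of_mem hx, hx'⟩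
  init_inj := h.init_inj
  init_current := h.init_current
  init_even := h.init_even

theorem BroadcastInv.enterRound {s : State c Block} (h : BroadcastInv s) (r : ℕ) :
    BroadcastInv (enterRound s r) where
  echo_spec v hv := h.echo_spec v (Finset.mem_of_mem_insert_of_ne hv (by simp))
  echo_inj u v hu hv := h.echo_inj u v (Finset.mem_of_mem_insert_of_ne hu (by simp))
    (Finset.mem_of_mem_insert_of_ne hv (by simp))
  ready_spec v hv := h.ready_spec v (Finset.mem_of_mem_insert_of_ne hv (by simp))
  delivered_spec := h.delivered_spec

/-- The state right after a vertex was added to the DAG and the commit rule was applied. -/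
theorem Inv.commitAll_insert {P : Protocol c Block} {s : State c Block} (h : Inv P s)
    {v : Vertex c Block} (hv : v ∈ s.buffer) (ha : Addable s v) :
    let s' := commitAll P { s with buffer := s.buffer.erase v, dag := insert v s.dag }
    SameDag { s with buffer := s.buffer.erase v, dag := insert v s.dag } s' ∧
    DagInv P s' ∧ BroadcastInv s' ∧ OrderInv s' ∧ (∀ r, ¬ Committable s' r) ∧ Later P s s' := by
  intro s'
  have hdag := h.dag.insert hv ha
  have horder : OrderInv { s with buffer := s.buffer.erase v, dag := insert v s.dag } := by
    obtain ⟨h1, h2, u, hu, hur⟩ := h.order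
    exact ⟨h1, h2, u, Finset.mem_insert_of_mem hu, hur⟩
  have hbr : BroadcastInv { s with buffer := s.buffer.erase v, dag := insert v s.dag } :=
    ⟨h.broadcast.1, h.broadcast.2, h.broadcast.3, h.broadcast.4⟩
  have e : SameDag _ s' := commitAll_sameDag P _
  obtain ⟨h1, h2, h3, h4⟩ := commitAll_spec P hdag.isDag horder
  refine ⟨e, hdag.congr e, hbr.congr e, h1, h2, ?_⟩
  exact
    { self := e.self
      inbox := e.inbox.ge
      sent := e.sent.ge
      delivered := e.delivered.ge
      dag := (Finset.subset_insert _ _).trans e.dag.ge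
      round := e.round.ge
      schedule := h3
      chain := fun D hD hsub hc => h4 D hD (e.dag.ge.trans hsub) hc }

theorem later_enterRound (P : Protocol c Block) {s : State c Block} {r : ℕ} (h : s.round ≤ r) :
    Later P s (enterRound s r) :=
  ⟨rfl, subset_rfl, Finset.subset_insert _ _, subset_rfl, subset_rfl, h, .inl rfl,
    fun _ _ _ h => h⟩

/-- A vertex that is added to the DAG lies at most one round above the current one, and then in
an odd round, for the rounds below it are full. -/
theorem Inv.round_le_of_addable {P : Protocol c Block} (hf : 3 * c.f < c.n) {s : State c Block}
    (h : Inv P s) {v : Vertex c Block} (hv : v ∈ s.buffer) (ha : Addable s v) :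
    v.round ≤ s.round ∨ (v.round = s.round + 1 ∧ Even s.round) := by
  obtain ⟨-, h1, h2⟩ := h.dag.buffer_origin v hv
  obtain ⟨q, hq⟩ := Finset.card_pos.1 (show 0 < v.edges.card by omega)
  obtain ⟨u, hu, hur, -⟩ := ha q hq
  have hfull : c.n - c.f ≤ (s.layer (v.round - 1)).card := by
    rw [← h.dag.isDag.card_layer_sources]
    refine h2.trans (Finset.card_le_card fun p hp => ?_)
    obtain ⟨x, hx, hxr, hxs⟩ := ha p hp
    exact Finset.mem_image.2 ⟨x, State.mem_layer.2 ⟨hx, by omega⟩, hxs⟩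
  obtain ⟨h3, h4⟩ := h.round _ hfull
  by_cases hle : v.round ≤ s.round
  · exact .inl hle
  · refine .inr ⟨by omega, ?_⟩
    rw [← Nat.not_odd_iff_even]
    intro ho
    have := h4 (by rwa [show v.round - 1 = s.round by omega])
    omega

/-- Entering round `r`, if the layer below is full, no layer from `r` on is, and no even round is
skipped. -/
theorem Inv.enterRound {P : Protocol c Block} {s : State c Block} {r : ℕ} (hdag : DagInv P s)
    (hbr : BroadcastInv s) (ho : OrderInv s) (hset : ∀ r, ¬ Committable s r)
    (hr : s.round < r) (hl : c.n - c.f ≤ (s.layer (r - 1)).card)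
    (he : ∀ r', Even r' → s.round < r' → r' ≤ r → r' = r)
    (hfull : ∀ k, c.n - c.f ≤ (s.layer k).card → k < r) : Inv P (enterRound s r) where
  dag := hdag.enterRound hr hl he
  round k hk := ⟨(hfull k hk).le, fun _ => hfull k hk⟩
  broadcast := hbr.enterRound r
  order := ⟨ho.1, ho.2, ho.3⟩
  settled := hset

theorem Transition.inv_add {P : Protocol c Block} (hf : 3 * c.f < c.n) {s : State c Block}
    (h : Inv P s) {v : Vertex c Block} (hv : v ∈ s.buffer) (ha : Addable s v) :
    Inv P (addToDag P { s with buffer := s.buffer.erase v } v) ∧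
      Later P s (addToDag P { s with buffer := s.buffer.erase v } v) := by
  obtain ⟨e, hdag, hbr, ho, hset, hlater⟩ := h.commitAll_insert hv ha
  have hc := addToDag_cases P { s with buffer := s.buffer.erase v } v
  dsimp only at e hdag hbr ho hset hlater hc
  set s' := commitAll P { s with buffer := s.buffer.erase v, dag := insert v s.dag } with hs'
  have hround : s'.round = s.round := e.round
  have hpos := (h.dag.buffer_origin v hv).2.1
  have hvr := h.round_le_of_addable hf hv ha
  have hother : ∀ k, k ≠ v.round → c.n - c.f ≤ (s'.layer k).card →
      k ≤ s'.round ∧ (Odd k → k < s'.round) := by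
    intro k hk hl
    rw [hround]
    refine h.round k (hl.trans (Finset.card_le_card fun u hu => ?_))
    obtain ⟨hu1, hu2⟩ := State.mem_layer.1 hu
    rw [e.dag] at hu1
    rcases Finset.mem_insert.1 hu1 with rfl | hu1
    · exact absurd hu2.symm hk
    · exact State.mem_layer.2 ⟨hu1, hu2⟩
  rcases hc with ⟨h1, h2, h3⟩ | ⟨h1, h2, h3, h4⟩ | ⟨h1, h2, h3⟩
  · rw [h3]
    refine ⟨Inv.enterRound hdag hbr ho hset (by omega) (by simpa using h2) ?_ ?_,
      hlater.trans (later_enterRound P (by omega))⟩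
    · intro r' hr' hlt hle
      rcases hvr with hvr | ⟨hvr, he⟩
      · omega
      · obtain ⟨i, hi⟩ := hr'
        obtain ⟨j, hj⟩ := he
        omega
    · intro k hk
      by_cases hkv : k = v.round
      · omega
      · have := (hother k hkv hk).1
        omega
  · rw [h4]
    refine ⟨Inv.enterRound hdag hbr ho hset (by omega) (by simpa using h2) ?_ ?_,
      hlater.trans (later_enterRound P (by omega))⟩
    · intro r' hr' hlt hle
      omega
    · intro k hk
      by_cases hkv : k = v.round
      · by_contra hcon
        exact h1 ⟨by omega, hkv ▸ hk⟩
      · have := (hother k hkv hk).1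
        omega
  · rw [h3]
    refine ⟨⟨hdag, fun k hk => ?_, hbr, ho, hset⟩, hlater⟩
    by_cases hkv : k = v.round
    · have hle : k ≤ s'.round := by
        by_contra hcon
        exact h1 ⟨by omega, hkv ▸ hk⟩
      refine ⟨hle, fun hodd => hle.lt_of_ne fun heq => h2 ?_⟩
      rw [← heq]
      exact ⟨hk, .inl hodd⟩
    · exact hother k hkv hk

/-- The invariants are preserved by the elementary transitions. -/
theorem Transition.inv {P : Protocol c Block} (hf : 3 * c.f < c.n) {s s' : State c Block}
    (t : Transition P s s') (h : Inv P s) : Inv P s' ∧ Later P s s' := by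
  obtain ⟨hd, hr, hb, ho, hset⟩ := h
  cases t with
  | hear x =>
    have hsub := Finset.subset_insert x s.inbox
    have hcount : ∀ m, s.count m ≤ State.count { s with inbox := insert x s.inbox } m :=
      fun m => count_mono (s' := { s with inbox := insert x s.inbox }) hsub m
    refine ⟨⟨⟨hd.1, hd.2, hd.3, hd.4, hd.5, hd.6, hd.7, hd.8, hd.9, hd.10, hd.11, hd.12⟩, hr,
      ⟨fun v hv => hsub (hb.1 v hv), hb.2, fun v hv => ?_, fun v hv => ?_⟩,
      ⟨ho.1, ho.2, ho.3⟩, hset⟩,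
      ⟨rfl, hsub, subset_rfl, subset_rfl, subset_rfl, le_rfl, .inl rfl, fun _ _ _ h => h⟩⟩
    · have h1 := hcount (Msg.echo v)
      have h2 := hcount (Msg.ready v)
      exact (hb.3 v hv).imp (fun h => by omega) fun h => by omega
    · exact (hb.4 v hv).trans (hcount _)
  | echo v hv hnew =>
    have hm : ∀ u, Msg.init u ∈ insert (Msg.echo v) s.sent → Msg.init u ∈ s.sent :=
      fun u hu => Finset.mem_of_mem_insert_of_ne hu (by simp)
    have hsub := Finset.subset_insert (Msg.echo v) s.sent
    refine ⟨⟨⟨hd.1, hd.2, hd.3, hd.4, hd.5, hd.6, hd.7, hd.8, fun u hu => hd.9 u (hm u hu),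
      fun u u' hu hu' => hd.10 u u' (hm u hu) (hm u' hu'),
      hd.11.imp fun u hu => ⟨hsub hu.1, hu.2⟩,
      fun r h1 h2 h3 => (hd.12 r h1 h2 h3).imp fun u hu => ⟨hsub hu.1, hu.2⟩⟩, hr,
      ⟨fun u hu => ?_, fun u u' hu hu' huu => ?_,
        fun u hu => hb.3 u (Finset.mem_of_mem_insert_of_ne hu (by simp)), hb.4⟩,
      ⟨ho.1, ho.2, ho.3⟩, hset⟩,
      ⟨rfl, subset_rfl, hsub, subset_rfl, subset_rfl, le_rfl, .inl rfl, fun _ _ _ h => h⟩⟩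
    · rcases Finset.mem_insert.1 hu with hu | hu
      · rw [Msg.echo.inj hu]
        exact hv
      · exact hb.1 u hu
    · rcases Finset.mem_insert.1 hu with hu | hu <;> rcases Finset.mem_insert.1 hu' with hu' | hu'
      · rw [Msg.echo.inj hu, Msg.echo.inj hu']
      · rw [Msg.echo.inj hu] at huu
        exact absurd ⟨huu.1.symm, huu.2.symm⟩ (hnew u' hu')
      · rw [Msg.echo.inj hu'] at huu
        exact absurd huu (hnew u hu)
      · exact hb.2 u u' hu hu' huu
  | ready v hv =>
    have hm : ∀ u, Msg.init u ∈ insert (Msg.ready v) s.sent → Msg.init u ∈ s.sent :=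
      fun u hu => Finset.mem_of_mem_insert_of_ne hu (by simp)
    have hsub := Finset.subset_insert (Msg.ready v) s.sent
    refine ⟨⟨⟨hd.1, hd.2, hd.3, hd.4, hd.5, hd.6, hd.7, hd.8, fun u hu => hd.9 u (hm u hu),
      fun u u' hu hu' => hd.10 u u' (hm u hu) (hm u' hu'),
      hd.11.imp fun u hu => ⟨hsub hu.1, hu.2⟩,
      fun r h1 h2 h3 => (hd.12 r h1 h2 h3).imp fun u hu => ⟨hsub hu.1, hu.2⟩⟩, hr,
      ⟨fun u hu => hb.1 u (Finset.mem_of_mem_insert_of_ne hu (by simp)),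
        fun u u' hu hu' => hb.2 u u' (Finset.mem_of_mem_insert_of_ne hu (by simp))
          (Finset.mem_of_mem_insert_of_ne hu' (by simp)), fun u hu => ?_, hb.4⟩,
      ⟨ho.1, ho.2, ho.3⟩, hset⟩,
      ⟨rfl, subset_rfl, hsub, subset_rfl, subset_rfl, le_rfl, .inl rfl, fun _ _ _ h => h⟩⟩
    rcases Finset.mem_insert.1 hu with hu | hu
    · rw [Msg.ready.inj hu]
      exact hv
    · exact hb.3 u hu
  | deliver v hc hnew h1 h2 =>
    have hsub := Finset.subset_insert v s.delivered
    refine ⟨⟨⟨hd.1, fun u hu => (hd.2 u hu).imp_right fun h => ⟨hsub h.1, h.2⟩, fun u hu => ?_,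
      fun u hu u' hu' huu => ?_, fun u hu h3 h4 => ?_, hd.6, hd.7, hd.8, hd.9, hd.10, hd.11,
      hd.12⟩, hr, ⟨hb.1, hb.2, hb.3, fun u hu => ?_⟩, ⟨ho.1, ho.2, ho.3⟩, hset⟩,
      ⟨rfl, subset_rfl, subset_rfl, hsub, subset_rfl, le_rfl, .inl rfl, fun _ _ _ h => h⟩⟩
    · rcases List.mem_cons.1 hu with rfl | hu
      · exact ⟨Finset.mem_insert_self _ _, h1, h2⟩
      · exact ⟨hsub (hd.3 u hu).1, (hd.3 u hu).2⟩
    · rcases Finset.mem_insert.1 hu with rfl | hold <;>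
        rcases Finset.mem_insert.1 hu' with rfl | hold'
      · rfl
      · exact absurd ⟨huu.1.symm, huu.2.symm⟩ (hnew u' hold')
      · exact absurd huu (hnew u hold)
      · exact hd.4 u hold u' hold' huu
    · rcases Finset.mem_insert.1 hu with rfl | hu
      · exact .inr List.mem_cons_self
      · exact (hd.5 u hu h3 h4).imp_right (List.mem_cons_of_mem _)
    · rcases Finset.mem_insert.1 hu with rfl | hu
      · exact hc
      · exact hb.4 u hu
  | discard v hc hnew h1 =>
    have hsub := Finset.subset_insert v s.delivered
    refine ⟨⟨⟨hd.1, fun u hu => (hd.2 u hu).imp_right fun h => ⟨hsub h.1, h.2⟩,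
      fun u hu => ⟨hsub (hd.3 u hu).1, (hd.3 u hu).2⟩,
      fun u hu u' hu' huu => ?_, fun u hu h3 h4 => ?_, hd.6, hd.7, hd.8, hd.9, hd.10, hd.11,
      hd.12⟩, hr, ⟨hb.1, hb.2, hb.3, fun u hu => ?_⟩, ⟨ho.1, ho.2, ho.3⟩, hset⟩,
      ⟨rfl, subset_rfl, subset_rfl, hsub, subset_rfl, le_rfl, .inl rfl, fun _ _ _ h => h⟩⟩
    · rcases Finset.mem_insert.1 hu with rfl | hold <;>
        rcases Finset.mem_insert.1 hu' with rfl | hold'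
      · rfl
      · exact absurd ⟨huu.1.symm, huu.2.symm⟩ (hnew u' hold')
      · exact absurd huu (hnew u hold)
      · exact hd.4 u hold u' hold' huu
    · rcases Finset.mem_insert.1 hu with rfl | hu
      · exact absurd ⟨h3, h4⟩ h1
      · exact hd.5 u hu h3 h4
    · rcases Finset.mem_insert.1 hu with rfl | hu
      · exact hc
      · exact hb.4 u hu
  | add v hv ha => exact Transition.inv_add hf ⟨hd, hr, hb, ho, hset⟩ hv ha
  | advance h1 h2 =>
    refine ⟨Inv.enterRound hd hb ho hset (by omega) (by simpa using h1) ?_ ?_,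
      later_enterRound P (by omega)⟩
    · intro r' hr' hlt hle
      omega
    · intro k hk
      have := (hr k hk).1
      omega

theorem Transitions.inv {P : Protocol c Block} (hf : 3 * c.f < c.n) {s s' : State c Block}
    (t : Transitions P s s') (h : Inv P s) : Inv P s' ∧ Later P s s' := by
  induction t with
  | refl => exact ⟨h, .refl P s⟩
  | tail _ t ih =>
    obtain ⟨h1, h2⟩ := t.inv hf ih.1
    exact ⟨h1, ih.2.trans h2⟩

/-! ### Rounds and the timer -/

/-- Between the two states either the round is unchanged and the timer was not touched, or a new
round was entered and the timer was reset. -/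
def Clock (s s' : State c Block) : Prop :=
  (s'.round = s.round ∧ s'.elapsed = s.elapsed) ∨ (s.round < s'.round ∧ s'.elapsed = 0)

theorem Clock.trans {s s' s'' : State c Block} (h : Clock s s') (h' : Clock s' s'') :
    Clock s s'' := by
  unfold Clock at *
  omega

theorem Transition.clock {P : Protocol c Block} {s s' : State c Block} (t : Transition P s s') :
    Clock s s' := by
  cases t with
  | add v hv ha =>
    have hc := addToDag_cases P { s with buffer := s.buffer.erase v } v
    have e := commitAll_sameDag P { s with buffer := s.buffer.erase v, dag := insert v s.dag }
    have h1 := e.round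
    have h2 := e.elapsed
    dsimp only at hc h1 h2
    rcases hc with ⟨h, -, h3⟩ | ⟨-, -, -, h3⟩ | ⟨-, -, h3⟩ <;> rw [h3]
    · exact .inr ⟨by simp only [enterRound]; omega, rfl⟩
    · exact .inr ⟨by simp only [enterRound]; omega, rfl⟩
    · exact .inl ⟨h1, h2⟩
  | advance => exact .inr ⟨Nat.lt_succ_self _, rfl⟩
  | _ => exact .inl ⟨rfl, rfl⟩

theorem Transitions.clock {P : Protocol c Block} {s s' : State c Block}
    (t : Transitions P s s') : Clock s s' := by
  induction t with
  | refl => exact .inl ⟨rfl, rfl⟩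
  | tail _ t ih => exact ih.trans t.clock

/-- A vertex of an odd round is broadcast on leaving the even round below it, either with the
anchor of that round in the DAG or after the timeout. -/
theorem Transition.init_odd {P : Protocol c Block} (hf : 3 * c.f < c.n) {s s' : State c Block}
    (t : Transition P s s') (h : Inv P s) {v : Vertex c Block} (hv : Msg.init v ∈ s'.sent)
    (hodd : Odd v.round) : Msg.init v ∈ s.sent ∨
      (v.round = s.round + 1 ∧ v.edges = (s'.layer s.round).image Vertex.source ∧
        ((s'.getAnchor s.round).isSome ∨ c.timeout ≤ s.elapsed)) := by
  cases t with
  | echo => exact .inl (Finset.mem_of_mem_insert_of_ne hv (by simp))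
  | ready => exact .inl (Finset.mem_of_mem_insert_of_ne hv (by simp))
  | add x hx ha =>
    have hc := addToDag_cases P { s with buffer := s.buffer.erase x } x
    have hxr := h.round_le_of_addable hf hx ha
    have e := commitAll_sameDag P { s with buffer := s.buffer.erase x, dag := insert x s.dag }
    dsimp only at hc e
    set s1 := commitAll P { s with buffer := s.buffer.erase x, dag := insert x s.dag } with hs1
    have hround : s1.round = s.round := e.round
    have hsent : s1.sent = s.sent := e.sent
    have hel : s1.elapsed = s.elapsed := e.elapsed
    rcases hc with ⟨h1, -, h3⟩ | ⟨-, -, h2, h3⟩ | ⟨-, -, h3⟩ <;> rw [h3] at hv ⊢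
    · rcases Finset.mem_insert.1 hv with hv | hv
      · obtain rfl := Msg.init.inj hv
        rcases hxr with hxr | ⟨hxr, he⟩
        · omega
        · obtain ⟨i, hi⟩ := hodd
          obtain ⟨j, hj⟩ := he
          simp only at hi
          omega
      · exact .inl (hsent ▸ hv)
    · rcases Finset.mem_insert.1 hv with hv | hv
      · obtain rfl := Msg.init.inj hv
        rw [hround, hel] at h2
        refine .inr ⟨by simp [hround], by simp [hround]; rfl, h2.resolve_left fun ho => ?_⟩
        obtain ⟨i, hi⟩ := hodd
        obtain ⟨j, hj⟩ := ho
        simp only at hi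
        omega
      · exact .inl (hsent ▸ hv)
    · exact .inl (hsent ▸ hv)
  | advance h1 h2 =>
    rcases Finset.mem_insert.1 hv with hv | hv
    · obtain rfl := Msg.init.inj hv
      refine .inr ⟨rfl, by simp; rfl, h2.resolve_left fun ho => ?_⟩
      obtain ⟨i, hi⟩ := hodd
      obtain ⟨j, hj⟩ := ho
      simp only at hi
      omega
    · exact .inl hv
  | _ => exact .inl hv

/-! ### What a party has done after handling a message -/

/-- After a message has been handled, every rule of reliable broadcast that is enabled has been
applied, and no vertex of the buffer can be added to the DAG. -/
structure ReceiptInv (s : State c Block) : Prop where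
  echoed : ∀ v, (v.source, Msg.init v) ∈ s.inbox → ∃ u, Msg.echo u ∈ s.sent ∧ SameInstance u v
  readied : ∀ v, (c.n + c.f < 2 * s.count (Msg.echo v) ∨ c.f + 1 ≤ s.count (Msg.ready v)) →
    ∃ u, Msg.ready u ∈ s.sent ∧ SameInstance u v
  handed : ∀ v, 2 * c.f + 1 ≤ s.count (Msg.ready v) → ∃ u ∈ s.delivered, SameInstance u v
  drained : ∀ v ∈ s.buffer, ¬ Addable s v

theorem addToDag_inbox_buffer (P : Protocol c Block) (s : State c Block) (v : Vertex c Block) :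
    (addToDag P s v).inbox = s.inbox ∧ (addToDag P s v).buffer = s.buffer := by
  have e := commitAll_sameDag P { s with dag := insert v s.dag }
  rcases addToDag_cases P s v with ⟨-, -, h⟩ | ⟨-, -, -, h⟩ | ⟨-, -, h⟩ <;> rw [h] <;>
    exact ⟨e.inbox, e.buffer⟩

theorem drainStep_inbox (P : Protocol c Block) (s : State c Block) :
    (drainStep P s).inbox = s.inbox := by
  unfold drainStep
  split
  · exact (addToDag_inbox_buffer P _ _).1
  · rfl

theorem drain_inbox (P : Protocol c Block) (s : State c Block) :
    (drain P s).inbox = s.inbox := by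
  unfold drain
  generalize s.buffer.length = k
  induction k with
  | zero => rfl
  | succ k ih => rw [Function.iterate_succ_apply', drainStep_inbox, ih]

theorem drain_drained (P : Protocol c Block) (s : State c Block) :
    ∀ v ∈ (drain P s).buffer, ¬ Addable (drain P s) v := by
  unfold drain
  suffices h : ∀ k, s.buffer.length ≤ k →
      ∀ v ∈ ((drainStep P)^[k] s).buffer, ¬ Addable ((drainStep P)^[k] s) v from h _ le_rfl
  intro k hk
  induction k generalizing s with
  | zero =>
    intro v hv
    replace hv : v ∈ s.buffer := hv
    have : s.buffer = [] := List.length_eq_zero_iff.1 (Nat.le_zero.1 hk)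
    simp [this] at hv
  | succ k ih =>
    rw [Function.iterate_succ_apply]
    cases hfind : s.buffer.find? (fun v => decide (Addable s v)) with
    | none =>
      have hfix : drainStep P s = s := by simp only [drainStep, hfind]
      rw [hfix, Function.iterate_fixed hfix]
      intro v hv
      simpa using List.find?_eq_none.1 hfind v hv
    | some v =>
      refine ih _ ?_
      have hm := List.mem_of_find?_eq_some hfind
      have hstep : drainStep P s = addToDag P { s with buffer := s.buffer.erase v } v := by
        simp only [drainStep, hfind]
      rw [hstep, (addToDag_inbox_buffer P _ _).2, List.length_erase_of_mem hm]
      omega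

theorem tryEcho_frame (s : State c Block) (v : Vertex c Block) :
    (tryEcho s v).inbox = s.inbox ∧ (tryEcho s v).buffer = s.buffer ∧
      (tryEcho s v).dag = s.dag := by
  unfold tryEcho
  split_ifs <;> exact ⟨rfl, rfl, rfl⟩

theorem tryReady_frame (s : State c Block) (v : Vertex c Block) :
    (tryReady s v).inbox = s.inbox ∧ (tryReady s v).buffer = s.buffer ∧
      (tryReady s v).dag = s.dag := by
  unfold tryReady
  split_ifs <;> exact ⟨rfl, rfl, rfl⟩

theorem tryDeliver_inbox (P : Protocol c Block) (s : State c Block) (v : Vertex c Block) :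
    (tryDeliver P s v).inbox = s.inbox := by
  unfold tryDeliver
  split_ifs
  · rw [drain_inbox]
  all_goals rfl

theorem receive_inbox (P : Protocol c Block) (s : State c Block) (x : Party c × Msg c Block) :
    (receive P s x).inbox = insert x s.inbox := by
  unfold receive
  rw [tryDeliver_inbox, (tryReady_frame _ _).1, (tryEcho_frame _ _).1]

theorem SameInstance.refl (v : Vertex c Block) : SameInstance v v := ⟨rfl, rfl⟩

theorem tryEcho_echoed (s : State c Block) (v : Vertex c Block)
    (h : (v.source, Msg.init v) ∈ s.inbox) :
    ∃ u, Msg.echo u ∈ (tryEcho s v).sent ∧ SameInstance u v := by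
  unfold tryEcho
  split_ifs with hg
  · exact ⟨v, Finset.mem_insert_self _ _, .refl v⟩
  · by_contra hcon
    push Not at hcon
    exact hg ⟨h, hcon⟩

theorem tryReady_readied (s : State c Block) (v : Vertex c Block)
    (h : c.n + c.f < 2 * s.count (Msg.echo v) ∨ c.f + 1 ≤ s.count (Msg.ready v)) :
    ∃ u, Msg.ready u ∈ (tryReady s v).sent ∧ SameInstance u v := by
  unfold tryReady
  split_ifs with hg
  · exact ⟨v, Finset.mem_insert_self _ _, .refl v⟩
  · by_contra hcon
    push Not at hcon
    exact hg ⟨h, hcon⟩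

theorem Inv.later {P : Protocol c Block} (hf : 3 * c.f < c.n) {s s' : State c Block}
    (h : Inv P s) (t : Transitions P s s') : Later P s s' := (t.inv hf h).2

theorem tryDeliver_handed {P : Protocol c Block} (hf : 3 * c.f < c.n) {s : State c Block}
    (hs : Inv P s) (v : Vertex c Block) (h : 2 * c.f + 1 ≤ s.count (Msg.ready v)) :
    ∃ u ∈ (tryDeliver P s v).delivered, SameInstance u v := by
  by_cases hnew : ∀ u ∈ s.delivered, ¬ SameInstance u v
  · unfold tryDeliver
    rw [if_pos ⟨h, hnew⟩]
    split_ifs with hg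
    · have hs' := ((Transition.deliver (P := P) s v h hnew hg.1 hg.2).inv hf hs).1
      exact ⟨v, (hs'.later hf (drain_transitions P _)).delivered (Finset.mem_insert_self _ _),
        .refl v⟩
    · exact ⟨v, Finset.mem_insert_self _ _, .refl v⟩
  · push Not at hnew
    obtain ⟨u, hu, huv⟩ := hnew
    exact ⟨u, (hs.later hf (tryDeliver_transitions P s v)).delivered hu, huv⟩

theorem tryDeliver_drained {P : Protocol c Block} {s : State c Block} (v : Vertex c Block)
    (h : ∀ u ∈ s.buffer, ¬ Addable s u) :
    ∀ u ∈ (tryDeliver P s v).buffer, ¬ Addable (tryDeliver P s v) u := by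
  unfold tryDeliver
  split_ifs
  · exact drain_drained P _
  · exact h
  · exact h

theorem count_insert_of_ne (s s' : State c Block) {x : Party c × Msg c Block}
    (h : s'.inbox = insert x s.inbox) {m : Msg c Block} (hm : m.vertex ≠ x.2.vertex) :
    s'.count m = s.count m := by
  unfold State.count
  congr 1
  ext q
  simp only [Finset.mem_filter, Finset.mem_univ, true_and, h, Finset.mem_insert]
  refine or_iff_right fun e => hm ?_
  rw [← e]

theorem ReceiptInv.receive_spec {P : Protocol c Block} (hf : 3 * c.f < c.n) {s : State c Block}
    (hs : Inv P s) (h : ReceiptInv s) (x : Party c × Msg c Block) :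
    ReceiptInv (receive P s x) := by
  have hbox := receive_inbox P s x
  have hlater := hs.later hf (receive_transitions P s x)
  obtain ⟨v, hv⟩ : ∃ v, v = x.2.vertex := ⟨_, rfl⟩
  obtain ⟨s0, hs0⟩ : ∃ s0 : State c Block, s0 = { s with inbox := insert x s.inbox } := ⟨_, rfl⟩
  have h0 : Inv P s0 := hs0 ▸ ((Transition.hear s x).inv hf hs).1
  have h1 : Inv P (tryEcho s0 v) := ((tryEcho_transitions P s0 v).inv hf h0).1
  have h2 : Inv P (tryReady (tryEcho s0 v) v) := ((tryReady_transitions P _ v).inv hf h1).1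
  have l2 := h2.later hf (tryDeliver_transitions P _ v)
  have l1 := (h1.later hf (tryReady_transitions P _ v)).trans l2
  have e : receive P s x = tryDeliver P (tryReady (tryEcho s0 v) v) v := by
    rw [hs0, hv]; rfl
  have b1 : (tryEcho s0 v).inbox = insert x s.inbox := by
    rw [(tryEcho_frame _ _).1, hs0]
  have b2 : (tryReady (tryEcho s0 v) v).inbox = insert x s.inbox := (tryReady_frame _ _).1.trans b1
  refine ⟨fun u hu => ?_, fun u hu => ?_, fun u hu => ?_, ?_⟩
  · by_cases huv : u = v
    · rw [huv] at hu ⊢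
      obtain ⟨y, hy, hyu⟩ := tryEcho_echoed s0 v (by rw [hs0]; exact hbox ▸ hu)
      exact ⟨y, e ▸ l1.sent hy, hyu⟩
    · rw [hbox] at hu
      rcases Finset.mem_insert.1 hu with hu | hu
      · refine absurd ?_ huv
        rw [hv, ← hu]
        rfl
      · obtain ⟨y, hy, hyu⟩ := h.echoed u hu
        exact ⟨y, hlater.sent hy, hyu⟩
  · by_cases huv : u = v
    · rw [huv] at hu ⊢
      have hc : ∀ m, (receive P s x).count m = (tryEcho s0 v).count m := fun m => by
        unfold State.count; rw [hbox, b1]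
      rw [hc, hc] at hu
      obtain ⟨y, hy, hyu⟩ := tryReady_readied _ v hu
      exact ⟨y, e ▸ l2.sent hy, hyu⟩
    · have hne : u ≠ x.2.vertex := hv ▸ huv
      rw [count_insert_of_ne s _ hbox (m := .echo u) hne,
        count_insert_of_ne s _ hbox (m := .ready u) hne] at hu
      obtain ⟨y, hy, hyu⟩ := h.readied u hu
      exact ⟨y, hlater.sent hy, hyu⟩
  · by_cases huv : u = v
    · rw [huv] at hu ⊢
      have hc : ∀ m, (receive P s x).count m =
          (tryReady (tryEcho s0 v) v).count m := fun m => by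
        unfold State.count; rw [hbox, b2]
      rw [hc] at hu
      exact e ▸ tryDeliver_handed hf h2 v hu
    · rw [count_insert_of_ne s _ hbox (m := .ready u) (hv ▸ huv)] at hu
      obtain ⟨y, hy, hyu⟩ := h.handed u hu
      exact ⟨y, hlater.delivered hy, hyu⟩
  · rw [e]
    refine tryDeliver_drained v fun u hu ha => ?_
    rw [(tryReady_frame _ _).2.1, (tryEcho_frame _ _).2.1, hs0] at hu
    refine h.drained u hu fun p hp => ?_
    obtain ⟨y, hy, hy'⟩ := ha p hp
    rw [(tryReady_frame _ _).2.2, (tryEcho_frame _ _).2.2, hs0] at hy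
    exact ⟨y, hy, hy'⟩

/-! ### One time step -/

/-- The invariants of the state of a party between two time steps. -/
structure Stable (P : Protocol c Block) (s : State c Block) : Prop where
  inv : Inv P s
  receipt : ReceiptInv s

/-- The passing of one unit of time. -/
def State.tick (s : State c Block) : State c Block := { s with elapsed := s.elapsed + 1 }

theorem step_eq (P : Protocol c Block) (s : State c Block) (l : List (Party c × Msg c Block)) :
    step P s l = tryAdvance (l.foldl (receive P) s).tick := rfl

theorem Inv.tick {P : Protocol c Block} {s : State c Block} (h : Inv P s) :
    Inv P s.tick ∧ Later P s s.tick := by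
  obtain ⟨⟨h1, h2, h3, h4, h5, h6, h7, h8, h9, h10, h11, h12⟩, hr, ⟨b1, b2, b3, b4⟩,
    ⟨o1, o2, o3⟩, hset⟩ := h
  exact ⟨⟨⟨h1, h2, h3, h4, h5, h6, h7, h8, h9, h10, h11, h12⟩, hr, ⟨b1, b2, b3, b4⟩,
    ⟨o1, o2, o3⟩, hset⟩, ⟨rfl, subset_rfl, subset_rfl, subset_rfl, subset_rfl, le_rfl, .inl rfl,
      fun _ _ _ h => h⟩⟩

theorem ReceiptInv.tryAdvance {s : State c Block} (h : ReceiptInv s) :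
    ReceiptInv (tryAdvance s) := by
  unfold HammerHead.tryAdvance
  split_ifs
  · obtain ⟨h1, h2, h3, h4⟩ := h
    refine ⟨fun v hv => ?_, fun v hv => ?_, h3, h4⟩
    · obtain ⟨u, hu, huv⟩ := h1 v hv
      exact ⟨u, Finset.mem_insert_of_mem hu, huv⟩
    · obtain ⟨u, hu, huv⟩ := h2 v hv
      exact ⟨u, Finset.mem_insert_of_mem hu, huv⟩
  · exact h

theorem Stable.foldl {P : Protocol c Block} (hf : 3 * c.f < c.n)
    (l : List (Party c × Msg c Block)) {s : State c Block} (h : Stable P s) :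
    Stable P (l.foldl (receive P) s) := by
  induction l generalizing s with
  | nil => exact h
  | cons x l ih =>
    exact ih ⟨((receive_transitions P s x).inv hf h.inv).1, h.receipt.receive_spec hf h.inv x⟩

theorem Stable.step_spec {P : Protocol c Block} (hf : 3 * c.f < c.n) {s : State c Block}
    (h : Stable P s) (l : List (Party c × Msg c Block)) :
    Stable P (step P s l) ∧ Later P s (step P s l) := by
  have h1 := h.foldl hf l
  have l1 := h.inv.later hf (foldl_receive_transitions P l s)
  have h2 := h1.inv.tick
  have h3 := (tryAdvance_transitions P (l.foldl (receive P) s).tick).inv hf h2.1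
  have hr : ReceiptInv (l.foldl (receive P) s).tick := by
    obtain ⟨r1, r2, r3, r4⟩ := h1.receipt
    exact ⟨r1, r2, r3, r4⟩
  exact ⟨⟨h3.1, hr.tryAdvance⟩, (l1.trans h2.2).trans h3.2⟩

theorem mem_step_inbox (P : Protocol c Block) (s : State c Block)
    (l : List (Party c × Msg c Block)) (x : Party c × Msg c Block) :
    x ∈ (step P s l).inbox ↔ x ∈ l ∨ x ∈ s.inbox := by
  have h : (step P s l).inbox = (l.foldl (receive P) s).inbox := by
    rw [step_eq]
    unfold tryAdvance
    split_ifs <;> rfl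
  rw [h]
  clear h
  induction l generalizing s with
  | nil => simp
  | cons y l ih =>
    rw [List.foldl_cons]
    refine (ih (receive P s y)).trans ?_
    rw [receive_inbox, Finset.mem_insert, List.mem_cons]
    tauto

/-- The timer runs as long as the round does not change, and is otherwise started afresh. -/
theorem step_elapsed (P : Protocol c Block) (s : State c Block)
    (l : List (Party c × Msg c Block)) :
    ((step P s l).round = s.round ∧ (step P s l).elapsed = s.elapsed + 1) ∨
      (s.round < (step P s l).round ∧ (step P s l).elapsed ≤ 1) := by
  have h1 := (foldl_receive_transitions P l s).clock
  have h2 := (tryAdvance_transitions P (l.foldl (receive P) s).tick).clock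
  rw [← step_eq] at h2
  unfold Clock State.tick at *
  dsimp only at h2
  omega

/-- A party does not stay in a round with `n - f` vertices after the timeout. -/
theorem Stable.step_timeout {P : Protocol c Block} (hf : 3 * c.f < c.n) {s : State c Block}
    (h : Stable P s) (l : List (Party c × Msg c Block))
    (hl : c.n - c.f ≤ (s.layer s.round).card) (hr : (step P s l).round = s.round) :
    s.elapsed + 1 < c.timeout := by
  have t := foldl_receive_transitions P l s
  have h1 := t.clock
  have h2 := (tryAdvance_transitions P (l.foldl (receive P) s).tick).clock
  rw [← step_eq] at h2
  have l1 := h.inv.later hf t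
  set s' := l.foldl (receive P) s with hs'
  have hround : s'.round = s.round := by
    unfold Clock State.tick at *
    dsimp only at h2
    omega
  have hel : s'.elapsed = s.elapsed := by
    unfold Clock at h1
    omega
  by_contra hcon
  have hadv : tryAdvance s'.tick = enterRound s'.tick (s'.tick.round + 1) := by
    unfold tryAdvance
    refine if_pos ⟨?_, .inr (.inr ?_)⟩
    · refine hl.trans (Finset.card_le_card ?_)
      have : s'.tick.round = s.round := hround
      rw [this]
      exact layer_subset l1.dag _
    · simp only [State.tick]
      omega
  rw [step_eq, ← hs', hadv] at hr
  simp only [enterRound, State.tick] at hr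
  omega

/-! ### The initial state -/

theorem initialState_stable (P : Protocol c Block) (hf : 3 * c.f < c.n) (p : Party c)
    (proposal : ℕ → Block) : Stable P (initialState P p proposal) := by
  have hdag : ∀ v, v ∈ (initialState P p proposal).dag ↔
      v = ⟨0, v.source, P.genesisBlock, ∅⟩ := by
    intro v
    simp only [initialState, enterRound, Finset.mem_image, Finset.mem_univ, true_and]
    constructor
    · rintro ⟨q, rfl⟩
      rfl
    · intro h
      exact ⟨v.source, h.symm⟩
  have hround : ∀ v ∈ (initialState P p proposal).dag, v.round = 0 := by
    intro v hv
    rw [(hdag v).1 hv]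
  have hsent : ∀ m, m ∈ (initialState P p proposal).sent ↔ m = Msg.init ⟨1, p, proposal 1,
      ((initialState P p proposal).layer 0).image Vertex.source⟩ := by
    intro m
    simp [initialState, enterRound, State.layer]
  have hsources : ((initialState P p proposal).layer 0).image Vertex.source = Finset.univ := by
    ext q
    simp only [Finset.mem_image, Finset.mem_univ, iff_true]
    exact ⟨⟨0, q, P.genesisBlock, ∅⟩, State.mem_layer.2 ⟨(hdag _).2 rfl, rfl⟩, rfl⟩
  have hlayer : c.n ≤ ((initialState P p proposal).layer 0).card := by
    have := Finset.card_image_le (s := (initialState P p proposal).layer 0) (f := Vertex.source)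
    rw [hsources] at this
    simpa using this
  have hcount : ∀ m, (initialState P p proposal).count m = 0 := by
    intro m
    simp [State.count, initialState, enterRound]
  have hp : 0 < c.n := by omega
  refine ⟨⟨⟨fun q => (hdag _).2 rfl, fun v hv => .inl ((hdag v).1 hv), ?_, ?_, ?_, ?_, le_rfl,
    ?_, ?_, ?_, ?_, ?_⟩, ?_, ⟨?_, ?_, ?_, ?_⟩, ⟨le_rfl, ?_, ?_⟩, ?_⟩, ⟨?_, ?_, ?_, ?_⟩⟩
  · intro v hv
    simp [initialState, enterRound] at hv
  · intro v hv
    simp [initialState, enterRound] at hv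
  · intro v hv
    simp [initialState, enterRound] at hv
  · intro v hv q hq
    rw [(hdag v).1 hv] at hq
    simp at hq
  · exact (Nat.sub_le _ _).trans hlayer
  · intro v hv
    obtain rfl := Msg.init.inj ((hsent _).1 hv)
    refine ⟨rfl, le_rfl, le_rfl, ?_, fun q _ => ?_⟩
    · rw [hsources]
      simp
    · exact ⟨⟨0, q, P.genesisBlock, ∅⟩, (hdag _).2 rfl, rfl, rfl⟩
  · intro u v hu hv _
    rw [Msg.init.inj ((hsent _).1 hu), Msg.init.inj ((hsent _).1 hv)]
  · exact ⟨_, (hsent _).2 rfl, rfl⟩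
  · intro r he h0 h1
    have : r ≤ 1 := h1
    have : r = 1 := by omega
    rw [this] at he
    exact absurd he (by decide)
  · intro r hr
    obtain ⟨v, hv⟩ := Finset.card_pos.1
      (show 0 < ((initialState P p proposal).layer r).card by omega)
    have hv := State.mem_layer.1 hv
    have h0 := hround v hv.1
    have h1 : (initialState P p proposal).round = 1 := rfl
    omega
  · intro v hv
    exact absurd ((hsent _).1 hv) (by simp)
  · intro u v hu
    exact absurd ((hsent _).1 hu) (by simp)
  · intro v hv
    exact absurd ((hsent _).1 hv) (by simp)
  · intro v hv
    simp [initialState, enterRound] at hv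
  · simp only [initialState, enterRound, Schedule.threshold]
    omega
  · exact ⟨⟨0, ⟨0, hp⟩, P.genesisBlock, ∅⟩, (hdag _).2 rfl, rfl⟩
  · rintro r ⟨-, -, w, -, v, hv, -⟩
    have hv := State.mem_layer.1 hv
    have := hround v hv.1
    omega
  · intro v hv
    simp [initialState, enterRound] at hv
  · intro v hv
    rw [hcount, hcount] at hv
    omega
  · intro v hv
    rw [hcount] at hv
    omega
  · intro v hv
    simp [initialState, enterRound] at hv

/-! ### Reliable broadcast in an execution -/

variable {P : Protocol c Block} {E : Execution P}

theorem Execution.stable (hf : 3 * c.f < c.n) {p : Party c} (hp : p ∈ E.honest) (t : ℕ) :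
    Stable P (E.state t p) := by
  induction t with
  | zero =>
    rw [E.state_zero p hp]
    exact initialState_stable P hf p _
  | succ t ih =>
    rw [E.state_succ p hp t]
    exact (ih.step_spec hf _).1

theorem Execution.inv (hf : 3 * c.f < c.n) {p : Party c} (hp : p ∈ E.honest) (t : ℕ) :
    Inv P (E.state t p) := (E.stable hf hp t).inv

theorem Execution.later (hf : 3 * c.f < c.n) {p : Party c} (hp : p ∈ E.honest) {t t' : ℕ}
    (h : t ≤ t') : Later P (E.state t p) (E.state t' p) := by
  induction h with
  | refl => exact .refl P _
  | @step m _ ih =>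
    refine ih.trans ?_
    rw [E.state_succ p hp m]
    exact ((E.stable hf hp m).step_spec hf _).2

theorem Execution.self_eq (hf : 3 * c.f < c.n) {p : Party c} (hp : p ∈ E.honest) (t : ℕ) :
    (E.state t p).self = p := by
  rw [(E.later hf hp (Nat.zero_le t)).self, E.state_zero p hp]
  rfl

theorem Execution.mem_inbox_of_sent (hf : 3 * c.f < c.n) {p q : Party c} (hp : p ∈ E.honest)
    (hq : q ∈ E.honest) {t t' : ℕ} {m : Msg c Block} (hm : m ∈ (E.state t q).sent)
    (ht : max E.GST t + c.delta ≤ t') : (q, m) ∈ (E.state t' p).inbox := by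
  obtain ⟨x, hx, hxm⟩ := E.delivery p hp q hq t m hm
  refine (E.later hf hp (show x + 1 ≤ t' by omega)).inbox ?_
  rw [E.state_succ p hp x, mem_step_inbox]
  exact .inl hxm

theorem Execution.sent_of_mem_inbox {p q : Party c} (hp : p ∈ E.honest)
    (hq : q ∈ E.honest) {t : ℕ} {m : Msg c Block} (hm : (q, m) ∈ (E.state t p).inbox) :
    ∃ t' < t, m ∈ (E.state t' q).sent := by
  induction t with
  | zero =>
    rw [E.state_zero p hp] at hm
    simp [initialState, enterRound] at hm
  | succ t ih =>
    rw [E.state_succ p hp t, mem_step_inbox] at hm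
    rcases hm with hm | hm
    · exact ⟨t, Nat.lt_succ_self t, E.authentic p hp q hq t m hm⟩
    · obtain ⟨t', ht', h⟩ := ih hm
      exact ⟨t', by omega, h⟩

theorem Execution.honest_card_le_count (hf : 3 * c.f < c.n) {p : Party c} (hp : p ∈ E.honest)
    {t t' : ℕ} {m : Msg c Block} {H : Finset (Party c)} (hH : H ⊆ E.honest)
    (hm : ∀ q ∈ H, m ∈ (E.state t q).sent)
    (ht : max E.GST t + c.delta ≤ t') : H.card ≤ (E.state t' p).count m :=
  Finset.card_le_card fun q hq =>
    Finset.mem_filter.2 ⟨Finset.mem_univ q, E.mem_inbox_of_sent hf hp (hH hq) (hm q hq) ht⟩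

/-- All but the faulty ones of the parties from which a message was received have sent it. -/
theorem Execution.count_le (hf : 3 * c.f < c.n) {p : Party c} (hp : p ∈ E.honest) (t : ℕ)
    (m : Msg c Block) : ∃ H ⊆ E.honest, (E.state (t + 1) p).count m + E.honest.card ≤ H.card + c.n ∧
      ∀ q ∈ H, m ∈ (E.state t q).sent := by
  refine ⟨E.honest.filter fun q => (q, m) ∈ (E.state (t + 1) p).inbox, Finset.filter_subset _ _,
    ?_, fun q hq => ?_⟩
  · unfold State.count
    have hsub : (Finset.univ.filter fun q => (q, m) ∈ (E.state (t + 1) p).inbox) ⊆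
        (E.honest.filter fun q => (q, m) ∈ (E.state (t + 1) p).inbox) ∪ E.honestᶜ := by
      intro q hq
      by_cases h : q ∈ E.honest
      · exact Finset.mem_union_left _ (Finset.mem_filter.2 ⟨h, (Finset.mem_filter.1 hq).2⟩)
      · exact Finset.mem_union_right _ (Finset.mem_compl.2 h)
    have h1 := (Finset.card_le_card hsub).trans (Finset.card_union_le _ _)
    have h2 := Finset.card_compl E.honest
    have h3 := Finset.card_le_univ E.honest
    rw [Fintype.card_fin] at h2 h3
    omega
  · obtain ⟨h1, h2⟩ := Finset.mem_filter.1 hq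
    obtain ⟨t', ht', hm⟩ := E.sent_of_mem_inbox hp h1 h2
    exact (E.later hf h1 (Nat.le_of_lt_succ ht')).sent hm

/-- Every vertex for which some honest party is ready was echoed by a quorum. -/
theorem Execution.echo_quorum_of_ready (hf : 3 * c.f < c.n) {p : Party c} (hp : p ∈ E.honest)
    {t : ℕ} {v : Vertex c Block} (hv : Msg.ready v ∈ (E.state t p).sent) :
    ∃ H ⊆ E.honest, 2 * E.honest.card + c.f < 2 * H.card + c.n ∧
      ∀ q ∈ H, Msg.echo v ∈ (E.state t q).sent := by
  induction t generalizing p with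
  | zero =>
    rw [E.state_zero p hp] at hv
    simp [initialState, enterRound] at hv
  | succ t ih =>
    rcases (E.inv hf hp (t + 1)).broadcast.ready_spec v hv with h | h
    · obtain ⟨H, hH, hcard, hsent⟩ := E.count_le hf hp t (Msg.echo v)
      exact ⟨H, hH, by omega, fun q hq => (E.later hf (hH hq) (Nat.le_succ t)).sent (hsent q hq)⟩
    · obtain ⟨H, hH, hcard, hsent⟩ := E.count_le hf hp t (Msg.ready v)
      have := E.few_faulty
      obtain ⟨q, hq⟩ := Finset.card_pos.1 (show 0 < H.card by omega)
      obtain ⟨H', hH', hcard', hsent'⟩ := ih (hH hq) (hsent q hq)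
      exact ⟨H', hH', hcard',
        fun q hq => (E.later hf (hH' hq) (Nat.le_succ t)).sent (hsent' q hq)⟩

/-- Two quorums of echoes share an honest party, which echoes one vertex per instance. -/
theorem Execution.ready_agree (hf : 3 * c.f < c.n) {p q : Party c} (hp : p ∈ E.honest)
    (hq : q ∈ E.honest) {t t' : ℕ} {u v : Vertex c Block}
    (hu : Msg.ready u ∈ (E.state t p).sent) (hv : Msg.ready v ∈ (E.state t' q).sent)
    (huv : SameInstance u v) : u = v := by
  obtain ⟨H, hH, hcard, hsent⟩ := E.echo_quorum_of_ready hf hp hu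
  obtain ⟨H', hH', hcard', hsent'⟩ := E.echo_quorum_of_ready hf hq hv
  have hne : (H ∩ H').Nonempty := by
    rw [← Finset.card_pos]
    have h1 := Finset.card_union_add_card_inter H H'
    have h2 := Finset.card_le_card (Finset.union_subset hH hH')
    have h3 := E.few_faulty
    omega
  obtain ⟨x, hx⟩ := hne
  obtain ⟨hx1, hx2⟩ := Finset.mem_inter.1 hx
  have hxh := hH hx1
  exact (E.inv hf hxh (max t t')).broadcast.echo_inj u v
    ((E.later hf hxh (le_max_left t t')).sent (hsent x hx1))
    ((E.later hf hxh (le_max_right t t')).sent (hsent' x hx2)) huv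

theorem Execution.ready_of_delivered (hf : 3 * c.f < c.n) {p : Party c} (hp : p ∈ E.honest)
    {t : ℕ} {v : Vertex c Block} (hv : v ∈ (E.state (t + 1) p).delivered) :
    ∃ H ⊆ E.honest, c.f + 1 ≤ H.card ∧ ∀ q ∈ H, Msg.ready v ∈ (E.state t q).sent := by
  have h := (E.inv hf hp (t + 1)).broadcast.delivered_spec v hv
  obtain ⟨H, hH, hcard, hsent⟩ := E.count_le hf hp t (Msg.ready v)
  have := E.few_faulty
  exact ⟨H, hH, by omega, hsent⟩

theorem Execution.pos_of_delivered {p : Party c} (hp : p ∈ E.honest) {t : ℕ}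
    {v : Vertex c Block} (hv : v ∈ (E.state t p).delivered) : ∃ t', t = t' + 1 := by
  cases t with
  | zero =>
    rw [E.state_zero p hp] at hv
    simp [initialState, enterRound] at hv
  | succ t => exact ⟨t, rfl⟩

theorem Execution.exists_ready_of_delivered (hf : 3 * c.f < c.n) {p : Party c}
    (hp : p ∈ E.honest) {t : ℕ} {v : Vertex c Block} (hv : v ∈ (E.state t p).delivered) :
    ∃ q ∈ E.honest, Msg.ready v ∈ (E.state t q).sent := by
  obtain ⟨t, rfl⟩ := E.pos_of_delivered hp hv
  obtain ⟨H, hH, hcard, hsent⟩ := E.ready_of_delivered hf hp hv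
  obtain ⟨q, hq⟩ := Finset.card_pos.1 (show 0 < H.card by omega)
  exact ⟨q, hH hq, (E.later hf (hH hq) (Nat.le_succ t)).sent (hsent q hq)⟩

/-- If all honest parties are ready for `v` at time `t`, all deliver it within `delta`. -/
theorem Execution.delivered_of_ready (hf : 3 * c.f < c.n) {t t' : ℕ} {v : Vertex c Block}
    (hv : ∀ q ∈ E.honest, Msg.ready v ∈ (E.state t q).sent) {p : Party c} (hp : p ∈ E.honest)
    (ht : max E.GST t + c.delta ≤ t') : v ∈ (E.state t' p).delivered := by
  have h1 := E.honest_card_le_count hf hp subset_rfl hv ht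
  have h2 := E.few_faulty
  obtain ⟨u, hu, huv⟩ := (E.stable hf hp t').receipt.handed v (by omega)
  obtain ⟨q, hq, hr⟩ := E.exists_ready_of_delivered hf hp hu
  rwa [← E.ready_agree hf hq hp hr (hv p hp) huv]

/-- Totality: a vertex that an honest party delivers is soon delivered by all. -/
theorem Execution.delivered_of_delivered (hf : 3 * c.f < c.n) {p q : Party c}
    (hp : p ∈ E.honest) (hq : q ∈ E.honest) {t t' : ℕ} {v : Vertex c Block}
    (hv : v ∈ (E.state (t + 1) p).delivered) (ht : max E.GST t + 2 * c.delta ≤ t') :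
    v ∈ (E.state t' q).delivered := by
  obtain ⟨H, hH, hcard, hsent⟩ := E.ready_of_delivered hf hp hv
  obtain ⟨x, hx⟩ := Finset.card_pos.1 (show 0 < H.card by omega)
  refine E.delivered_of_ready hf (t := max E.GST t + c.delta) (fun y hy => ?_) hq (by omega)
  have h1 := E.honest_card_le_count hf hy hH hsent le_rfl
  obtain ⟨u, hu, huv⟩ := (E.stable hf hy (max E.GST t + c.delta)).receipt.readied v
    (.inr (by omega))
  rwa [← E.ready_agree hf hy (hH hx) hu (hsent x hx) huv]

/-- A valid delivered vertex whose edges lead into the DAG is in the DAG. -/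
theorem Stable.mem_dag {s : State c Block} (h : Stable P s) {v : Vertex c Block}
    (hv : v ∈ s.delivered) (hr : 1 ≤ v.round) (hc : c.n - c.f ≤ v.edges.card)
    (he : ∀ q ∈ v.edges, ∃ u ∈ s.dag, u.round + 1 = v.round ∧ u.source = q) : v ∈ s.dag :=
  (h.inv.dag.kept v hv hr hc).resolve_right fun hb => h.receipt.drained v hb he

theorem Execution.dag_subset_succ (hf : 3 * c.f < c.n) {p q : Party c}
    (hp : p ∈ E.honest) (hq : q ∈ E.honest) {t t' : ℕ}
    (ht : max E.GST t + 2 * c.delta ≤ t') : (E.state (t + 1) p).dag ⊆ (E.state t' q).dag := by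
  intro v hv
  induction k : v.round generalizing v with
  | zero =>
    rcases (E.inv hf hp (t + 1)).dag.dag_origin v hv with h | h
    · rw [h]
      exact (E.inv hf hq t').dag.genesis _
    · omega
  | succ k ih =>
    rcases (E.inv hf hp (t + 1)).dag.dag_origin v hv with h | h
    · rw [h] at k
      simp at k
    · refine (E.stable hf hq t').mem_dag (E.delivered_of_delivered hf hp hq h.1 ht) h.2.1 h.2.2
        fun x hx => ?_
      obtain ⟨u, hu, hur, hus⟩ := (E.inv hf hp (t + 1)).dag.closed v hv x hx
      exact ⟨u, ih hu (by omega), hur, hus⟩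

theorem Execution.dag_subset (hf : 3 * c.f < c.n) {p q : Party c}
    (hp : p ∈ E.honest) (hq : q ∈ E.honest) {t t' : ℕ}
    (ht : max E.GST t + 2 * c.delta ≤ t') : (E.state t p).dag ⊆ (E.state t' q).dag :=
  (E.later hf hp (Nat.le_succ t)).dag.trans (E.dag_subset_succ hf hp hq ht)

/-- An honest party broadcasts a single vertex per round, so that no other vertex of the same
instance is ever echoed. -/
theorem Execution.init_of_echo (hf : 3 * c.f < c.n) {p q : Party c} (hp : p ∈ E.honest)
    (hq : q ∈ E.honest) {t : ℕ} {v : Vertex c Block} (hs : v.source = q)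
    (hv : Msg.echo v ∈ (E.state t p).sent) : Msg.init v ∈ (E.state t q).sent := by
  have h := (E.inv hf hp t).broadcast.echo_spec v hv
  rw [hs] at h
  obtain ⟨t', ht', h'⟩ := E.sent_of_mem_inbox hp hq h
  exact (E.later hf hq ht'.le).sent h'

theorem Execution.init_of_ready (hf : 3 * c.f < c.n) {p q : Party c} (hp : p ∈ E.honest)
    (hq : q ∈ E.honest) {t : ℕ} {v : Vertex c Block} (hs : v.source = q)
    (hv : Msg.ready v ∈ (E.state t p).sent) : Msg.init v ∈ (E.state t q).sent := by
  obtain ⟨H, hH, hcard, hsent⟩ := E.echo_quorum_of_ready hf hp hv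
  have h1 := E.few_faulty
  have h2 := Finset.card_le_univ E.honest
  rw [Fintype.card_fin] at h2
  obtain ⟨x, hx⟩ := Finset.card_pos.1 (show 0 < H.card by omega)
  exact E.init_of_echo hf (hH hx) hq hs (hsent x hx)

theorem Execution.init_of_mem_dag (hf : 3 * c.f < c.n) {p q : Party c} (hp : p ∈ E.honest)
    (hq : q ∈ E.honest) {t : ℕ} {v : Vertex c Block} (hs : v.source = q)
    (hv : v ∈ (E.state t p).dag) (hr : 1 ≤ v.round) : Msg.init v ∈ (E.state t q).sent := by
  rcases (E.inv hf hp t).dag.dag_origin v hv with h | h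
  · rw [h] at hr
    simp at hr
  · obtain ⟨x, hx, hx'⟩ := E.exists_ready_of_delivered hf hp h.1
    exact E.init_of_ready hf hx hq hs hx'

theorem Execution.init_unique (hf : 3 * c.f < c.n) {p : Party c} (hp : p ∈ E.honest) {t t' : ℕ}
    {u v : Vertex c Block} (hu : Msg.init u ∈ (E.state t p).sent)
    (hv : Msg.init v ∈ (E.state t' p).sent) (h : u.round = v.round) : u = v :=
  (E.inv hf hp (max t t')).dag.init_inj u v ((E.later hf hp (le_max_left t t')).sent hu)
    ((E.later hf hp (le_max_right t t')).sent hv) h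

/-- Validity: the vertices of honest parties are soon in the DAG of every honest party. -/
theorem Execution.mem_dag_of_init (hf : 3 * c.f < c.n) {p q : Party c} (hp : p ∈ E.honest)
    (hq : q ∈ E.honest) {t t' : ℕ} {v : Vertex c Block} (hv : Msg.init v ∈ (E.state t p).sent)
    (ht : max E.GST t + 3 * c.delta ≤ t') : v ∈ (E.state t' q).dag := by
  obtain ⟨h1, h2, h3, h4, h5⟩ := (E.inv hf hp t).dag.init_spec v hv
  rw [E.self_eq hf hp] at h1
  have hfew := E.few_faulty
  have hecho : ∀ x ∈ E.honest, Msg.echo v ∈ (E.state (max E.GST t + c.delta) x).sent := by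
    intro x hx
    have hbox := E.mem_inbox_of_sent hf hx hp hv le_rfl
    obtain ⟨u, hu, huv⟩ := (E.stable hf hx _).receipt.echoed v (by rwa [h1])
    rwa [← E.init_unique hf hp (E.init_of_echo hf hx hp (huv.2.trans h1) hu) hv huv.1]
  have hready : ∀ x ∈ E.honest, Msg.ready v ∈ (E.state (max E.GST t + 2 * c.delta) x).sent := by
    intro x hx
    have hcount := E.honest_card_le_count hf hx subset_rfl hecho
      (show _ ≤ max E.GST t + 2 * c.delta by omega)
    obtain ⟨u, hu, huv⟩ := (E.stable hf hx (max E.GST t + 2 * c.delta)).receipt.readied v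
      (.inl (by omega))
    rwa [← E.init_unique hf hp (E.init_of_ready hf hx hp (huv.2.trans h1) hu) hv huv.1]
  refine (E.stable hf hq t').mem_dag (E.delivered_of_ready hf hready hq (by omega)) h2 h4
    fun x hx => ?_
  obtain ⟨u, hu, hu'⟩ := h5 x hx
  exact ⟨u, E.dag_subset hf hp hq (by omega) hu, hu'⟩

/-! ### Progress of the rounds -/

/-- A round is entered with a full layer below it, and by causal closure all lower layers are full
too. -/
theorem Execution.full_below (hf : 3 * c.f < c.n) {p : Party c} (hp : p ∈ E.honest) {t r : ℕ}
    (hr : r < (E.state t p).round) : c.n - c.f ≤ ((E.state t p).layer r).card := by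
  have h := (E.inv hf hp t).dag
  have hl := h.layer_below
  by_cases hr' : r = (E.state t p).round - 1
  · rwa [hr']
  · obtain ⟨v, hv⟩ := Finset.card_pos.1
      (show 0 < ((E.state t p).layer ((E.state t p).round - 1)).card by omega)
    obtain ⟨hv, hvr⟩ := State.mem_layer.1 hv
    exact h.isDag.card_layer hf hv (by omega)

theorem full_of_subset {s s' : State c Block} (h : s.dag ⊆ s'.dag) {r : ℕ}
    (hl : c.n - c.f ≤ (s.layer r).card) : c.n - c.f ≤ (s'.layer r).card :=
  hl.trans (Finset.card_le_card (layer_subset h r))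

/-- A party leaves a round with `n - f` vertices when the timeout expires at the latest. -/
theorem Execution.lt_round_of_full (hf : 3 * c.f < c.n) {p : Party c} (hp : p ∈ E.honest)
    {t r : ℕ} (hl : c.n - c.f ≤ ((E.state t p).layer r).card) :
    r < (E.state (t + c.timeout + 1) p).round := by
  have hle := ((E.inv hf hp t).round r hl).1
  by_contra hcon
  have hround : ∀ k ≤ c.timeout + 1, (E.state (t + k) p).round = r := by
    intro k hk
    have h1 := (E.later hf hp (show t ≤ t + k by omega)).round
    have h2 := (E.later hf hp (show t + k ≤ t + c.timeout + 1 by omega)).round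
    omega
  have hel : ∀ k ≤ c.timeout, k ≤ (E.state (t + k) p).elapsed := by
    intro k
    induction k with
    | zero => intro _; exact Nat.zero_le _
    | succ k ih =>
      intro hk
      have h1 := ih (by omega)
      have h2 := hround k (by omega)
      have h3 := hround (k + 1) (by omega)
      have h4 := step_elapsed P (E.state (t + k) p) (E.received (t + k) p)
      rw [← E.state_succ p hp (t + k)] at h4
      rw [← Nat.add_assoc] at h3 ⊢
      omega
  have h1 := hround c.timeout (by omega)
  have h2 := hround (c.timeout + 1) le_rfl
  rw [← Nat.add_assoc, E.state_succ p hp] at h2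
  have h3 := (E.stable hf hp (t + c.timeout)).step_timeout hf
    (E.received (t + c.timeout) p) ?_ (h2.trans h1.symm)
  · have := hel c.timeout le_rfl
    omega
  · rw [h1]
    exact full_of_subset (E.later hf hp (Nat.le_add_right _ _)).dag hl

/-- A bound on the time that the fastest honest party spends in a round after `GST`. -/
def Params.roundTime (c : Params) : ℕ := 5 * c.delta + 2 * c.timeout + 2

theorem Execution.exists_succ_round (hf : 3 * c.f < c.n) {t r : ℕ} (ht : E.GST ≤ t)
    (h : ∃ p ∈ E.honest, r ≤ (E.state t p).round) :
    ∃ p ∈ E.honest, r + 1 ≤ (E.state (t + c.roundTime) p).round := by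
  obtain ⟨p, hp, hr⟩ := h
  by_cases h0 : r = 0
  · exact ⟨p, hp, by have := (E.inv hf hp (t + c.roundTime)).dag.round_pos; omega⟩
  have hfull := E.full_below hf hp (show r - 1 < (E.state t p).round by omega)
  obtain ⟨y, hy⟩ : ∃ y, y = t + 2 * c.delta + c.timeout + 1 := ⟨_, rfl⟩
  -- The vertices that let `p` enter round `r` bring all honest parties to round `r`.
  have hall : ∀ q ∈ E.honest, r ≤ (E.state y q).round := by
    intro q hq
    have := E.lt_round_of_full hf hq (full_of_subset
      (E.dag_subset hf hp hq (show max E.GST t + 2 * c.delta ≤ t + 2 * c.delta by omega)) hfull)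
    rw [hy]
    omega
  have hz : y + 3 * c.delta + c.timeout + 1 = t + c.roundTime := by
    simp only [Params.roundTime]
    omega
  by_contra hcon
  push Not at hcon
  have hround : ∀ q ∈ E.honest, (E.state y q).round = r := by
    intro q hq
    have h1 := hcon q hq
    have h2 := hall q hq
    have h3 := (E.later hf hq (show y ≤ t + c.roundTime by omega)).round
    omega
  have hlayer : c.n - c.f ≤ ((E.state (y + 3 * c.delta) p).layer r).card := by
    have hsub : E.honest ⊆ ((E.state (y + 3 * c.delta) p).layer r).image Vertex.source := by
      intro q hq
      obtain ⟨v, hv, hvr⟩ := (E.inv hf hq y).dag.init_current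
      have hs := ((E.inv hf hq y).dag.init_spec v hv).1
      rw [E.self_eq hf hq] at hs
      exact Finset.mem_image.2 ⟨v, State.mem_layer.2
        ⟨E.mem_dag_of_init hf hq hp hv (by omega), hvr.trans (hround q hq)⟩, hs⟩
    have h1 := (Finset.card_le_card hsub).trans Finset.card_image_le
    have h2 := E.few_faulty
    omega
  have h1 := E.lt_round_of_full hf hp hlayer
  rw [hz] at h1
  have h2 := hcon p hp
  omega

theorem Execution.exists_round_add (hf : 3 * c.f < c.n) {t r : ℕ} (ht : E.GST ≤ t)
    (h : ∃ p ∈ E.honest, r ≤ (E.state t p).round) (N : ℕ) :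
    ∃ p ∈ E.honest, r + N ≤ (E.state (t + N * c.roundTime) p).round := by
  induction N with
  | zero => simpa using h
  | succ N ih =>
    rw [Nat.succ_mul, ← Nat.add_assoc t, ← Nat.add_assoc r]
    exact E.exists_succ_round hf (by omega) ih

/-! ### Agreement on schedules -/

theorem Execution.chain (hf : 3 * c.f < c.n) {p : Party c} (hp : p ∈ E.honest) {t : ℕ}
    {D : Finset (Vertex c Block)} (hD : IsDag D) (hsub : (E.state t p).dag ⊆ D) :
    Chain P D (E.state t p).schedule := by
  refine (E.later hf hp (Nat.zero_le t)).chain D hD hsub ?_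
  rw [E.state_zero p hp]
  exact .initial

/-- A party whose DAG contains that of another one has advanced at least as far. -/
theorem Execution.index_le_of_dag_subset (hf : 3 * c.f < c.n) {p q : Party c}
    (hp : p ∈ E.honest) (hq : q ∈ E.honest) {t t' : ℕ}
    (h : (E.state t p).dag ⊆ (E.state t' q).dag) :
    (E.state t p).schedule.index ≤ (E.state t' q).schedule.index := by
  have hi := E.inv hf hq t'
  have hD := hi.dag.isDag
  exact Chain.index_le hD hf hi.order hi.settled (E.chain hf hq hD subset_rfl)
    (E.chain hf hp hD h)

theorem Execution.schedule_eq_of_dag_subset (hf : 3 * c.f < c.n) {p q : Party c}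
    (hp : p ∈ E.honest) (hq : q ∈ E.honest) {t t' : ℕ}
    (h : (E.state t p).dag ⊆ (E.state t' q).dag)
    (hi : (E.state t' q).schedule.index ≤ (E.state t p).schedule.index) :
    (E.state t' q).schedule = (E.state t p).schedule := by
  have hD := (E.inv hf hq t').dag.isDag
  exact (E.chain hf hq hD subset_rfl).unique hD hf (E.chain hf hp hD h)
    (hi.antisymm (E.index_le_of_dag_subset hf hp hq h))

/-! ### Votes for an honest leader -/

/-- On leaving the even round `r`, a party points to the vertex of the leader of that round, unless
the timeout has expired before the vertex is in its DAG. -/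
theorem Transition.init_votes (hf : 3 * c.f < c.n) {s s' : State c Block}
    (t : Transition P s s') (h : Inv P s) {r : ℕ} (hr : Even r)
    (hel : s.round = r → c.timeout ≤ s.elapsed →
      ∃ w ∈ s.dag, w.round = r ∧ w.source = s'.schedule.leader r)
    {v : Vertex c Block} (hv : Msg.init v ∈ s'.sent) (hvr : v.round = r + 1) :
    Msg.init v ∈ s.sent ∨ s'.schedule.leader r ∈ v.edges := by
  refine (t.init_odd hf h hv (hvr ▸ hr.add_one)).imp_right fun ⟨h1, h2, h3⟩ => ?_
  obtain rfl : s.round = r := by omega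
  rw [h2, Finset.mem_image]
  rcases h3 with h3 | h3
  · exact State.getAnchor_isSome.1 h3
  · obtain ⟨w, hw, hwr, hws⟩ := hel rfl h3
    exact ⟨w, State.mem_layer.2 ⟨(t.inv hf h).2.dag hw, hwr⟩, hws⟩

/-- If the schedule is the same in the first and in the last state of a sequence of transitions, it
is so in between, and the timer runs on or is reset, so that no timeout expires only in between. -/
theorem Transitions.init_votes (hf : 3 * c.f < c.n) {s s' : State c Block}
    (t : Transitions P s s') (h : Inv P s) (hS : s'.schedule = s.schedule) {r : ℕ}
    (hr : Even r) (hpos : 0 < c.timeout)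
    (hel : s.round = r → c.timeout ≤ s.elapsed →
      ∃ w ∈ s.dag, w.round = r ∧ w.source = s.schedule.leader r)
    {v : Vertex c Block} (hv : Msg.init v ∈ s'.sent) (hvr : v.round = r + 1) :
    Msg.init v ∈ s.sent ∨ s.schedule.leader r ∈ v.edges := by
  induction t with
  | refl => exact .inl hv
  | @tail s1 s2 t t' ih =>
    have h1 := Transitions.inv hf t h
    have h2 := t'.inv hf h1.1
    have hS1 : s1.schedule = s.schedule := by
      refine h1.2.schedule.resolve_right fun hlt => ?_
      have := h2.2.index
      rw [hS] at this
      omega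
    refine (t'.init_votes hf h1.1 hr (fun h3 h4 => ?_) hv hvr).elim (ih hS1) fun h => .inr (hS ▸ h)
    rcases Transitions.clock t with ⟨hc1, hc2⟩ | ⟨-, hc2⟩
    · obtain ⟨w, hw, hw'⟩ := hel (hc1 ▸ h3) (hc2 ▸ h4)
      exact ⟨w, h1.2.dag hw, hS ▸ hw'⟩
    · omega

theorem Stable.init_votes (hf : 3 * c.f < c.n) {s : State c Block} (h : Stable P s)
    (l : List (Party c × Msg c Block)) (hS : (step P s l).schedule = s.schedule) {r : ℕ}
    (hr : Even r) (htime : 2 ≤ c.timeout)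
    (hel : s.round = r → c.timeout ≤ s.elapsed + 1 →
      ∃ w ∈ s.dag, w.round = r ∧ w.source = s.schedule.leader r)
    {v : Vertex c Block} (hv : Msg.init v ∈ (step P s l).sent) (hvr : v.round = r + 1) :
    Msg.init v ∈ s.sent ∨ s.schedule.leader r ∈ v.edges := by
  have t1 := foldl_receive_transitions P l s
  have t2 := tryAdvance_transitions P (l.foldl (receive P) s).tick
  rw [← step_eq] at t2
  set s' := l.foldl (receive P) s with hs'
  have h1 := Transitions.inv hf t1 h.inv
  have h2 := h1.1.tick
  have h3 := Transitions.inv hf t2 h2.1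
  have hS1 : s'.schedule = s.schedule := by
    refine h1.2.schedule.resolve_right fun hlt => ?_
    have := (h2.2.trans h3.2).index
    rw [hS] at this
    omega
  have key := Transitions.init_votes hf t2 h2.1 (hS.trans hS1.symm) hr (by omega)
    (fun h4 h5 => ?_) hv hvr
  · rcases key with hkey | hkey
    · exact Transitions.init_votes hf t1 h.inv hS1 hr (by omega)
        (fun h4 h5 => hel h4 (by omega)) hkey hvr
    · exact .inr (hS1 ▸ hkey)
  · change s'.round = r at h4
    change c.timeout ≤ s'.elapsed + 1 at h5
    rcases Transitions.clock t1 with ⟨hc1, hc2⟩ | ⟨-, hc2⟩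
    · obtain ⟨w, hw, hw'⟩ := hel (hc1 ▸ h4) (hc2 ▸ h5)
      exact ⟨w, h1.2.dag hw,
        (congrArg (fun S => w.round = r ∧ w.source = S.leader r) hS1).mpr hw'⟩
    · omega

/-- If a party enters round `r` at time `x` at the earliest, its timer was started at `x - 1` at the
earliest: a timer reset while messages are handled still ticks at the end of the same step. -/
theorem Execution.elapsed_add_le {p : Party c} (hp : p ∈ E.honest) {r x : ℕ} (hr : 2 ≤ r)
    (hx : ∀ t < x, (E.state t p).round < r) (t : ℕ) (ht : (E.state t p).round = r) :
    (E.state t p).elapsed + x ≤ t + 1 := by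
  induction t with
  | zero =>
    rw [E.state_zero p hp] at ht
    have : (initialState P p (E.proposal p)).round = 1 := rfl
    omega
  | succ t ih =>
    have h := step_elapsed P (E.state t p) (E.received t p)
    rw [← E.state_succ p hp t] at h
    have hxt : x ≤ t + 1 := by
      by_contra hcon
      have := hx (t + 1) (by omega)
      omega
    rcases h with ⟨h1, h2⟩ | ⟨-, h2⟩
    · have := ih (h1.symm.trans ht)
      omega
    · omega

/-- Suppose that the first honest parties to enter the even round `r` do so at time `x + 1`, that
all honest parties have the schedule `S` from `x` to `t₂`, and that its leader of round `r` is
honest.  Then the leader's vertex reaches all honest parties before their timeouts, so that the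
vertices of round `r + 1` that they broadcast until `t₂` point to it. -/
theorem Execution.votes_for_leader (hf : 3 * c.f < c.n) (hdelta : 0 < c.delta)
    (htimeout : 6 * c.delta ≤ c.timeout) {S : Schedule c} {r x t₂ : ℕ} (hr : Even r) (hr2 : 2 ≤ r)
    (hx : E.GST ≤ x) (hbefore : ∀ t ≤ x, ∀ q ∈ E.honest, (E.state t q).round < r)
    (henter : ∃ q ∈ E.honest, r ≤ (E.state (x + 1) q).round)
    (hS : ∀ t, x ≤ t → t ≤ t₂ → ∀ q ∈ E.honest, (E.state t q).schedule = S)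
    (hleader : S.leader r ∈ E.honest) {q : Party c} (hq : q ∈ E.honest) {v : Vertex c Block}
    {t : ℕ} (ht : t ≤ t₂) (hv : Msg.init v ∈ (E.state t q).sent) (hvr : v.round = r + 1) :
    S.leader r ∈ v.edges := by
  obtain ⟨p, hp, hpr⟩ := henter
  -- Round `r - 1` is full and odd, so that the leader has left it by time `x + 2 * c.delta`.
  have hodd : Odd (r - 1) := by
    obtain ⟨i, hi⟩ := hr
    exact ⟨i - 1, by omega⟩
  have hfull := E.full_below hf hp (show r - 1 < (E.state (x + 1) p).round by omega)
  have hround : r ≤ (E.state (x + 2 * c.delta) (S.leader r)).round := by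
    have := ((E.inv hf hleader (x + 2 * c.delta)).round (r - 1) (full_of_subset
      (E.dag_subset_succ hf hp hleader (by omega)) hfull)).2 hodd
    omega
  obtain ⟨w, hw, hwr⟩ := (E.inv hf hleader (x + 2 * c.delta)).dag.init_even r hr (by omega) hround
  have hws := ((E.inv hf hleader (x + 2 * c.delta)).dag.init_spec w hw).1
  rw [E.self_eq hf hleader] at hws
  induction t with
  | zero =>
    have h1 := ((E.inv hf hq 0).dag.init_spec v hv).2.2.1
    have h2 := hbefore 0 (Nat.zero_le x) q hq
    omega
  | succ t ih =>
    by_cases hxt : t + 1 ≤ x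
    · have h1 := ((E.inv hf hq (t + 1)).dag.init_spec v hv).2.2.1
      have h2 := hbefore (t + 1) hxt q hq
      omega
    · have hSt := hS t (by omega) (by omega) q hq
      have hSt' := hS (t + 1) (by omega) ht q hq
      rw [E.state_succ q hq t] at hv hSt'
      have key := (E.stable hf hq t).init_votes hf (E.received t q) (hSt'.trans hSt.symm) hr
        (by omega) (fun h1 h2 => ?_) hv hvr
      · rw [hSt] at key
        exact key.elim (ih (by omega)) id
      -- A timeout of round `r` expires after time `x + 5 * c.delta`, when `w` is in all DAGs.
      · have h3 := E.elapsed_add_le hq hr2 (x := x + 1)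
          (fun t' ht' => hbefore t' (by omega) q hq) t h1
        exact ⟨w, E.mem_dag_of_init hf hleader hq hw (by omega), hwr, hSt ▸ hws⟩

/-- If all honest vertices of round `r + 1` point to the leader's vertex of round `r`, then that
vertex is supported in every DAG that reaches round `r + 2`, for `n - f` of the vertices of round
`r + 1` have at least `f + 1` honest ones among them. -/
theorem Execution.exists_supported (hf : 3 * c.f < c.n) {S : Schedule c} {r t : ℕ} (hr : Even r)
    {p : Party c} (hp : p ∈ E.honest) (hround : r + 3 ≤ (E.state t p).round)
    (hvotes : ∀ q ∈ E.honest, ∀ v, Msg.init v ∈ (E.state t q).sent → v.round = r + 1 →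
      S.leader r ∈ v.edges) : ∃ w, w.round = r ∧ Supported (E.state t p).dag S w := by
  have hd := (E.inv hf hp t).dag.isDag
  have hfew := E.few_faulty
  have hfull := E.full_below hf hp (show r + 2 < (E.state t p).round by omega)
  obtain ⟨v, hv⟩ := Finset.card_pos.1 (show 0 < ((E.state t p).layer (r + 2)).card by omega)
  obtain ⟨hvd, hvr⟩ := State.mem_layer.1 hv
  have hcard : c.f + 1 ≤ (E.honest ∩ v.edges).card := by
    have h1 := Finset.card_union_add_card_inter E.honest v.edges
    have h2 := Finset.card_le_univ (E.honest ∪ v.edges)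
    have h3 := hd.card_edges v hvd (by omega)
    rw [Fintype.card_fin] at h2
    omega
  have hvoter : ∀ q ∈ E.honest ∩ v.edges, ∃ u ∈ (E.state t p).dag, u.round = r + 1 ∧
      u.source = q ∧ S.leader r ∈ u.edges := by
    intro q hq
    obtain ⟨hq1, hq2⟩ := Finset.mem_inter.1 hq
    obtain ⟨u, hu, hur, hus⟩ := hd.closed v hvd q hq2
    exact ⟨u, hu, by omega, hus,
      hvotes q hq1 u (E.init_of_mem_dag hf hp hq1 hus hu (by omega)) (by omega)⟩
  obtain ⟨q, hq⟩ := Finset.card_pos.1 (show 0 < (E.honest ∩ v.edges).card by omega)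
  obtain ⟨u, hu, hur, -, hul⟩ := hvoter q hq
  obtain ⟨w, hw, hwr, hws⟩ := hd.closed u hu _ hul
  obtain rfl : w.round = r := by omega
  refine ⟨w, rfl, hw, hws, hr, v, hvd, hvr, hcard.trans ?_⟩
  refine (Finset.card_le_card fun q hq => ?_).trans
    (Finset.card_image_le (f := Vertex.source))
  obtain ⟨u, hu, hur, rfl, hul⟩ := hvoter q hq
  refine Finset.mem_image.2 ⟨u, Finset.mem_filter.2 ⟨Finset.mem_filter.2 ⟨hu, hur⟩,
    (Finset.mem_inter.1 hq).2, .single ⟨hw, hur.symm, hws ▸ hul⟩⟩, rfl⟩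

/-- The first summand of the bound is the time in which all honest parties catch up with `S`, the
second one the time in which the fastest of them gets past a suitable round with an honest
leader. -/
theorem Execution.exists_index_lt (hf : 3 * c.f < c.n) (hdelta : 0 < c.delta)
    (htimeout : 6 * c.delta ≤ c.timeout) {W : ℕ} {S : Schedule c}
    (hS : E.IsLatestScheduleBeforeGST S) (hW : S.HasLeadersIn W E.honest) :
    ∃ p ∈ E.honest, ∃ t ≤ E.GST + (2 * c.delta + (c.T + 2 * W + 5) * c.roundTime),
      S.index < (E.state t p).schedule.index := by
  by_contra hcon
  push Not at hcon
  obtain ⟨⟨p₀, hp₀, t₀, ht₀, hS₀⟩, -⟩ := hS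
  obtain ⟨t₁, ht₁⟩ : ∃ t₁, t₁ = E.GST + 2 * c.delta := ⟨_, rfl⟩
  obtain ⟨t₂, ht₂⟩ : ∃ t₂, t₂ = t₁ + (c.T + 2 * W + 5) * c.roundTime := ⟨_, rfl⟩
  have hle : t₁ ≤ t₂ := ht₂ ▸ Nat.le_add_right _ _
  -- From `t₁` on, every honest party has caught up with `S`.
  have hsched : ∀ t, t₁ ≤ t → t ≤ t₂ → ∀ q ∈ E.honest, (E.state t q).schedule = S := by
    intro t h1 h2 q hq
    rw [← hS₀]
    exact E.schedule_eq_of_dag_subset hf hp₀ hq (E.dag_subset hf hp₀ hq (by omega))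
      (hS₀ ▸ hcon q hq t (by omega))
  obtain ⟨m, hm, hmax⟩ := E.honest.exists_max_image (fun q => (E.state t₁ q).round) ⟨p₀, hp₀⟩
  set M := (E.state t₁ m).round with hM
  have hinit : S.initialRound ≤ M + 1 := by
    obtain ⟨v, hv, hvr⟩ := (E.inv hf hp₀ t₀).order.exists_initial
    rw [hS₀] at hvr
    have hv' := E.dag_subset hf hp₀ hm (show max E.GST t₀ + 2 * c.delta ≤ t₁ by omega) hv
    by_contra hlt
    have hfull := (E.inv hf hm t₁).dag.isDag.card_layer hf hv' (r := M + 1) (by omega)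
    have := ((E.inv hf hm t₁).round _ hfull).1
    omega
  -- The first even round with an honest leader that nobody has entered at `t₁`, and that is late
  -- enough to end `S`.
  obtain ⟨i, hi, hlead⟩ := hW ((M + c.T + 4) / 2)
  obtain ⟨r, hr⟩ : ∃ r, r = 2 * ((M + c.T + 4) / 2 + i) := ⟨_, rfl⟩
  rw [← hr] at hlead
  have hreven : Even r := ⟨(M + c.T + 4) / 2 + i, by omega⟩
  have hthreshold : S.threshold ≤ r := by
    unfold Schedule.threshold
    omega
  obtain ⟨p₂, hp₂, hround⟩ := E.exists_round_add hf (t := t₁) (r := M) (by omega)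
    ⟨m, hm, le_rfl⟩ (c.T + 2 * W + 5)
  rw [← ht₂] at hround
  have hex : ∃ t, ∃ q ∈ E.honest, r ≤ (E.state t q).round := ⟨t₂, p₂, hp₂, by omega⟩
  obtain ⟨hq, hmin⟩ := And.intro (Nat.find_spec hex) fun t => Nat.find_min hex (m := t)
  have hlate : t₁ < Nat.find hex := by
    obtain ⟨q, hq, hqr⟩ := hq
    by_contra hlt
    have h1 := (E.later hf hq (show Nat.find hex ≤ t₁ by omega)).round
    have h2 := hmax q hq
    omega
  obtain ⟨x, hx⟩ : ∃ x, Nat.find hex = x + 1 := ⟨Nat.find hex - 1, by omega⟩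
  rw [hx] at hq hmin hlate
  have hbefore : ∀ t ≤ x, ∀ q ∈ E.honest, (E.state t q).round < r := by
    intro t ht q hq
    by_contra hlt
    exact hmin t (by omega) ⟨q, hq, by omega⟩
  obtain ⟨w, hwr, hw⟩ := E.exists_supported hf (S := S) (t := t₂) hreven hp₂ (by omega)
    fun q' hq' v hv hvr => E.votes_for_leader hf hdelta htimeout hreven (by omega) (by omega)
      hbefore hq (fun t h1 h2 => hsched t (by omega) h2) hlead hq' le_rfl hv hvr
  have hinv := E.inv hf hp₂ t₂
  have hS₂ := hsched t₂ hle le_rfl p₂ hp₂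
  refine hinv.settled r ((committable_iff hinv.dag.isDag).2 ⟨?_, w, hwr, hS₂ ▸ hw⟩)
  have := hinv.order.last_lt
  rw [hS₂] at this
  omega

end HammerHead

theorem mainTheorem3 (c : HammerHead.Params) (hf : 3 * c.f < c.n) (hdelta : 0 < c.delta)
    (htimeout : 6 * c.delta ≤ c.timeout) (W : ℕ) :
    ∃ B : ℕ, ∀ (Block : Type*) (P : HammerHead.Protocol c Block) (E : HammerHead.Execution P)
      (Smax : HammerHead.Schedule c),
      E.IsLatestScheduleBeforeGST Smax → Smax.HasLeadersIn W E.honest →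
        ∃ p ∈ E.honest, ∃ t ≤ E.GST + B, E.HasEntered t p (Smax.index + 1) :=
  ⟨2 * c.delta + (c.T + 2 * W + 5) * c.roundTime, fun _ _ _ _ hS hW =>
    HammerHead.Execution.exists_index_lt hf hdelta htimeout hS hW⟩
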